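/- All groups below are groups of homeomorphisms, and words in them act on the right (the leftmost letter is applied first). Groups. Let $T$ be the group of piecewise $PSL_2(\mathbf Z)$ homeomorphisms of the circle $\mathbf S^1=\mathbf R\cup\{\infty\}$ with finitely many breakpoints, all in $\mathbf Q\cup\{\infty\}$, and let $F$ be the subgroup of elements of $T$ fixing $\infty$ (i.e. the piecewise $PSL_2(\mathbf Z)$ homeomorphisms of $\mathbf R$ with finitely many breakpoints, all rational). Let $c,\mathbf s$ be the homeomorphisms of $\mathbf S^1$ fixing $\infty$ with $$c(t)=\begin{cases} t & t\le 0\\ \frac{2t}{1+t} & 0\le t\le 1\\ t & t\ge 1\end{cases}\qquad \mathbf s(t)=\begin{cases} t & t\le 0\\ \frac{2t}{1+t} & 0\le t\le 1\\ \frac{2}{3-t} & 1\le t\le 2\\ t& t\ge 2.\end{cases}$$ Put $G_0=\langle F,c\rangle$ (the Lodha–Moore group) and $S=\langle T,\mathbf s\rangle$. Let $BB(1,2)$ be the group of homeomorphisms of $\mathbf R$ generated by $t\mapsto t+1$, the map equal to $t$ for $t\le0$ and to $2t$ for $t\ge 0$, and the map equal to $2t$ for $t\le 0$ and to $t$ for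 $t\ge 0$. Binary sequences. Let $y$ be the bijection of $2^{\mathbf N}$ with $y(00\eta)=0\,y(\eta)$, $y(01\eta)=10\,y^{-1}(\eta)$, $y(1\eta)=11\,y(\eta)$. For a finite binary sequence $s$ and a bijection $g$ of $2^{\mathbf N}$, the localization $g_s$ of $g$ at $s$ maps $s\eta$ to $s\,g(\eta)$ and fixes every sequence that does not extend $s$; write $y_s$ for the localization of $y$ at $s$. A standard form is a word $g\,y_{s_1}^{t_1}\cdots y_{s_n}^{t_n}$ in which $g$ is a tree diagram map (it is given by $u_i\xi\mapsto v_i\xi$, where $u_1,\dots,u_m$ and $v_1,\dots,v_m$ are the leaves, from left to right, of two finite rooted binary trees), $t_i\in\mathbf Z\setminus\{0\}$, and, for all $i<j$, either $s_j$ is a proper initial segment of $s_i$ or neither of $s_i,s_j$ is a proper initial segment of the other. The two models. Let $\varphi:2^{\mathbf N}\to[0,\infty]$ be the map with $\varphi(0\xi)=\frac{1}{1+1/\varphi(\xi)}$ and $\varphi(1\xi)=1+\varphi(\xi)$, and let $\Phi:2^{\mathbf N}\to\mathbf R\cup\{\infty\}$ be given by $\Phi(0\xi)=-\varphi(\tilde\xi)$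 and $\Phi(1\xi)=\varphi(\xi)$, where $\tilde\xi$ is $\xi$ with the digits $0$ and $1$ exchanged. A word acting on $2^{\mathbf N}$ by a map $w$ represents the homeomorphism $h$ of $\mathbf S^1$ if $\Phi(w(\xi))=h(\Phi(\xi))$ for all $\xi\in 2^{\mathbf N}$. Statement. The group $G_0$ embeds in $S$: there is an injective homomorphism $\phi:G_0\to S$ such that, whenever a standard form $g\,y_{s_1}^{t_1}\cdots y_{s_n}^{t_n}$ represents an element $h\in G_0$, the element $\phi(h)$ is represented by $$y_{110}^{-t}\; g_{10}\; y_{10s_1}^{t_1}\cdots y_{10s_n}^{t_n},\qquad t=\sum_{i=1}^n t_i ,$$ where $g_{10}$ is the localization of $g$ at $10$. As a consequence, $BB(1,2)$ embeds in $S$: there is an injective homomorphism $BB(1,2)\to S$. -/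

import Mathlib

namespace LodhaMoore

open Topology Matrix

noncomputable section

/-! ### Piecewise projective homeomorphisms of the line and of the circle -/

/-- The circle `ℝ ∪ {∞}`. -/
abbrev Circ : Type := OnePoint ℝ

/-- The action of `SL₂(ℤ)` on `ℝ ∪ {∞}` by fractional linear transformations. -/
def mobius (A : SpecialLinearGroup (Fin 2) ℤ) (x : Circ) : Circ :=
  ((SpecialLinearGroup.map (Int.castRingHom ℝ) A : SpecialLinearGroup (Fin 2) ℝ) :
    GL (Fin 2) ℝ) • x

/-- The subset `ℚ ∪ {∞}` of the circle. -/
def ratPoints : Set Circ := insert OnePoint.infty (Set.range fun q : ℚ => ((q : ℝ) : Circ))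

/-- Thompson's group `T`: the homeomorphisms of the circle that agree locally with elements of
`PSL₂(ℤ)` away from finitely many breakpoints, all of which lie in `ℚ ∪ {∞}`. -/
def thompsonT : Set (Circ ≃ₜ Circ) :=
  {h | ∃ B : Set Circ, B.Finite ∧ B ⊆ ratPoints ∧
    ∀ x ∉ B, ∃ A : SpecialLinearGroup (Fin 2) ℤ, ∀ᶠ y in 𝓝 x, h y = mobius A y}

/-- Thompson's group `F`: the piecewise `PSL₂(ℤ)` homeomorphisms of the real line (that is, of the
circle, fixing `∞`) with finitely many breakpoints, all rational. -/
def thompsonF : Set (Circ ≃ₜ Circ) :=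
  {h | h ∈ thompsonT ∧ h OnePoint.infty = OnePoint.infty}

/-- `c(t) = t` for `t ≤ 0`, `2t/(1+t)` for `0 ≤ t ≤ 1`, and `t` for `t ≥ 1`. -/
def cFun (t : ℝ) : ℝ := if t ≤ 0 then t else if t ≤ 1 then 2 * t / (1 + t) else t

/-- `s(t) = t` for `t ≤ 0`, `2t/(1+t)` for `0 ≤ t ≤ 1`, `2/(3-t)` for `1 ≤ t ≤ 2`,
and `t` for `t ≥ 2`. -/
def sFun (t : ℝ) : ℝ :=
  if t ≤ 0 then t else if t ≤ 1 then 2 * t / (1 + t) else if t ≤ 2 then 2 / (3 - t) else t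

/-- `bend p q (t) = p t` for `t ≤ 0` and `q t` for `t ≥ 0`. -/
def bendFun (p q t : ℝ) : ℝ := if t ≤ 0 then p * t else q * t

theorem cFun_strictMono : StrictMono cFun := by
  intro u v huv
  have key : ∀ w : ℝ, 0 < w → w ≤ 1 → 0 < 2 * w / (1 + w) ∧ 2 * w / (1 + w) ≤ 1 := by
    intro w h0 h1
    exact ⟨by positivity, by rw [div_le_one (by linarith)]; linarith⟩
  unfold cFun
  split_ifs with h1 h2 h3 h4 h5 h6
  all_goals first
    | linarith
    | linarith [(key v (by linarith) (by linarith)).1]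
    | linarith [(key u (by linarith) (by linarith)).2]
    | (rw [div_lt_div_iff₀ (by linarith) (by linarith)]; nlinarith)

theorem cFun_surjective : Function.Surjective cFun := by
  intro v
  rcases le_or_gt v 0 with h | h
  · exact ⟨v, by simp [cFun, h]⟩
  rcases le_or_gt v 1 with h1 | h1
  · have h2 : 0 < 2 - v := by linarith
    refine ⟨v / (2 - v), ?_⟩
    have a : ¬ v / (2 - v) ≤ 0 := not_le.2 (by positivity)
    have b : v / (2 - v) ≤ 1 := by rw [div_le_one h2]; linarith
    simp only [cFun, if_neg a, if_pos b]
    field_simp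
    ring
  · exact ⟨v, by simp [cFun, not_le.2 h, not_le.2 h1]⟩

theorem sFun_strictMono : StrictMono sFun := by
  intro u v huv
  have key : ∀ w : ℝ, 0 < w → w ≤ 1 → 0 < 2 * w / (1 + w) ∧ 2 * w / (1 + w) ≤ 1 := by
    intro w h0 h1
    exact ⟨by positivity, by rw [div_le_one (by linarith)]; linarith⟩
  have key' : ∀ w : ℝ, 1 < w → w ≤ 2 → 1 < 2 / (3 - w) ∧ 2 / (3 - w) ≤ 2 := by
    intro w h0 h1
    exact ⟨by rw [lt_div_iff₀ (by linarith)]; linarith,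
      by rw [div_le_iff₀ (by linarith)]; linarith⟩
  unfold sFun
  split_ifs
  all_goals first
    | linarith
    | linarith [(key v (by linarith) (by linarith)).1]
    | linarith [(key' v (by linarith) (by linarith)).1]
    | linarith [(key u (by linarith) (by linarith)).2]
    | linarith [(key' u (by linarith) (by linarith)).2]
    | linarith [(key u (by linarith) (by linarith)).2, (key' v (by linarith) (by linarith)).1]
    | (rw [div_lt_div_iff₀ (by linarith) (by linarith)]; nlinarith)

theorem sFun_surjective : Function.Surjective sFun := by
  intro v
  rcases le_or_gt v 0 with h | h
  · exact ⟨v, by simp [sFun, h]⟩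
  rcases le_or_gt v 1 with h1 | h1
  · have h2 : 0 < 2 - v := by linarith
    refine ⟨v / (2 - v), ?_⟩
    have a : ¬ v / (2 - v) ≤ 0 := not_le.2 (by positivity)
    have b : v / (2 - v) ≤ 1 := by rw [div_le_one h2]; linarith
    simp only [sFun, if_neg a, if_pos b]
    field_simp
    ring
  rcases le_or_gt v 2 with h2 | h2
  · have e : 3 - (3 - 2 / v) = 2 / v := by ring
    have a : 1 < 3 - 2 / v := by
      have : 2 / v < 2 := by rw [div_lt_iff₀ h]; linarith
      linarith
    have b : 3 - 2 / v ≤ 2 := by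
      have : 1 ≤ 2 / v := by rw [le_div_iff₀ h]; linarith
      linarith
    refine ⟨3 - 2 / v, ?_⟩
    simp only [sFun, if_neg (not_le.2 (lt_trans one_pos a)), if_neg (not_le.2 a), if_pos b, e]
    field_simp
  · exact ⟨v, by simp [sFun, not_le.2 h, not_le.2 h1, not_le.2 h2]⟩

theorem bendFun_strictMono {p q : ℝ} (hp : 0 < p) (hq : 0 < q) : StrictMono (bendFun p q) := by
  intro u v huv
  unfold bendFun
  split_ifs with h1 h2 h2
  · exact mul_lt_mul_of_pos_left huv hp
  · have := mul_pos hq (not_le.1 h2)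
    have := mul_nonneg hp.le (neg_nonneg.2 h1)
    linarith
  · linarith
  · exact mul_lt_mul_of_pos_left huv hq

theorem bendFun_surjective {p q : ℝ} (hp : 0 < p) (hq : 0 < q) :
    Function.Surjective (bendFun p q) := by
  intro v
  rcases le_or_gt v 0 with h | h
  · refine ⟨v / p, ?_⟩
    have : v / p ≤ 0 := div_nonpos_of_nonpos_of_nonneg h hp.le
    simp only [bendFun, if_pos this]
    field_simp
  · refine ⟨v / q, ?_⟩
    have : ¬ v / q ≤ 0 := not_le.2 (by positivity)
    simp only [bendFun, if_neg this]
    field_simp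

/-- The homeomorphism of the real line given by a strictly increasing surjection. -/
def lineHomeo (f : ℝ → ℝ) (hf : StrictMono f) (hs : Function.Surjective f) : ℝ ≃ₜ ℝ :=
  (hf.orderIsoOfSurjective f hs).toHomeomorph

@[simp]
theorem lineHomeo_apply (f : ℝ → ℝ) (hf : StrictMono f) (hs : Function.Surjective f) (t : ℝ) :
    lineHomeo f hf hs t = f t := rfl

/-- The map `c`, as a homeomorphism of the circle fixing `∞`. -/
def cMap : Circ ≃ₜ Circ := (lineHomeo cFun cFun_strictMono cFun_surjective).onePointCongr

/-- The map `s`, as a homeomorphism of the circle fixing `∞`. -/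
def sMap : Circ ≃ₜ Circ := (lineHomeo sFun sFun_strictMono sFun_surjective).onePointCongr

/-- The Lodha–Moore group `G₀`, generated by `F` and `c`. -/
def G0 : Subgroup (Circ ≃ₜ Circ) := Subgroup.closure (thompsonF ∪ {cMap})

/-- The group `S`, generated by `T` and `s`. -/
def S : Subgroup (Circ ≃ₜ Circ) := Subgroup.closure (thompsonT ∪ {sMap})

/-- The group `BB(1,2)` of homeomorphisms of the line, generated by `η(t) = t + 1`, by `ν₁`
(`t` for `t ≤ 0`, `2t` for `t ≥ 0`) and by `ν₂` (`2t` for `t ≤ 0`, `t` for `t ≥ 0`). -/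
def BB12 : Subgroup (ℝ ≃ₜ ℝ) :=
  Subgroup.closure
    {Homeomorph.addRight 1,
      lineHomeo (bendFun 1 2) (bendFun_strictMono one_pos two_pos)
        (bendFun_surjective one_pos two_pos),
      lineHomeo (bendFun 2 1) (bendFun_strictMono two_pos one_pos)
        (bendFun_surjective two_pos one_pos)}

/-! ### Binary sequences -/

/-- Infinite binary sequences; the digit `0` is `false` and the digit `1` is `true`. -/
abbrev Cantor : Type := ℕ → Bool

/-- The sequence `b ξ`. -/
def cons (b : Bool) (ξ : Cantor) : Cantor
  | 0 => b
  | n + 1 => ξ n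

/-- The sequence `ξ` without its first digit. -/
def tail (ξ : Cantor) : Cantor := fun n => ξ (n + 1)

/-- The sequence `s ξ`, for a finite sequence `s`. -/
def prepend (s : List Bool) (ξ : Cantor) : Cantor := s.foldr cons ξ

@[simp] theorem cons_zero (b : Bool) (ξ : Cantor) : cons b ξ 0 = b := rfl

@[simp] theorem cons_succ (b : Bool) (ξ : Cantor) (n : ℕ) : cons b ξ (n + 1) = ξ n := rfl

@[simp] theorem tail_cons (b : Bool) (ξ : Cantor) : tail (cons b ξ) = ξ := rfl

theorem cons_tail (ξ : Cantor) : cons (ξ 0) (tail ξ) = ξ := by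
  funext n; cases n <;> rfl

theorem cons_tail' {ξ : Cantor} {b : Bool} (h : ξ 0 = b) : cons b (tail ξ) = ξ := by
  rw [← h, cons_tail]

/-- `yDigit n true ξ` and `yDigit n false ξ` are the `n`-th digits of `y(ξ)` and `y⁻¹(ξ)`. -/
def yDigit : ℕ → Bool → Cantor → Bool
  | 0, true, ξ => if ξ 0 then true else ξ 1
  | 0, false, ξ => if ξ 0 then ξ 1 else false
  | 1, true, ξ =>
      if ξ 0 then true else if ξ 1 then false else yDigit 0 true (tail (tail ξ))
  | 1, false, ξ =>
      if ξ 0 then (if ξ 1 then yDigit 0 false (tail (tail ξ)) else true) else false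
  | n + 2, true, ξ =>
      if ξ 0 then yDigit n true (tail ξ)
      else if ξ 1 then yDigit n false (tail (tail ξ)) else yDigit (n + 1) true (tail (tail ξ))
  | n + 2, false, ξ =>
      if ξ 0 then
        (if ξ 1 then yDigit (n + 1) false (tail (tail ξ)) else yDigit n true (tail (tail ξ)))
      else yDigit n false (tail ξ)

/-- `yFun true` is the map `y` and `yFun false` is the map `y⁻¹`. -/
def yFun (ε : Bool) (ξ : Cantor) : Cantor := fun n => yDigit n ε ξ

/-- `y(00η) = 0 y(η)` -/
theorem y_zero_zero (η : Cantor) :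
    yFun true (cons false (cons false η)) = cons false (yFun true η) := by
  funext n; rcases n with _ | _ | n <;> simp [yFun, yDigit, cons, tail] <;> by_cases h : η 0 = true <;> simp [h]

/-- `y(01η) = 10 y⁻¹(η)` -/
theorem y_zero_one (η : Cantor) :
    yFun true (cons false (cons true η)) = cons true (cons false (yFun false η)) := by
  funext n; rcases n with _ | _ | n <;> simp [yFun, yDigit, cons]

/-- `y(1η) = 11 y(η)` -/
theorem y_one (η : Cantor) :
    yFun true (cons true η) = cons true (cons true (yFun true η)) := by
  funext n; rcases n with _ | _ | n <;> simp [yFun, yDigit, cons]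

/-- `y⁻¹(0η) = 00 y⁻¹(η)` -/
theorem yInv_zero (η : Cantor) :
    yFun false (cons false η) = cons false (cons false (yFun false η)) := by
  funext n; rcases n with _ | _ | n <;> simp [yFun, yDigit, cons]

/-- `y⁻¹(10η) = 01 y(η)` -/
theorem yInv_one_zero (η : Cantor) :
    yFun false (cons true (cons false η)) = cons false (cons true (yFun true η)) := by
  funext n; rcases n with _ | _ | n <;> simp [yFun, yDigit, cons]

/-- `y⁻¹(11η) = 1 y⁻¹(η)` -/
theorem yInv_one_one (η : Cantor) :
    yFun false (cons true (cons true η)) = cons true (yFun false η) := by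
  funext n; rcases n with _ | _ | n <;> simp [yFun, yDigit, cons, tail] <;> by_cases h : η 0 = true <;> simp [h]

theorem yFun_yFun (n : ℕ) : ∀ (ε : Bool) (ξ : Cantor), yFun (!ε) (yFun ε ξ) n = ξ n := by
  induction n using Nat.strong_induction_on with
  | _ n ih =>
    intro ε ξ
    rcases ε with _ | _
    · rcases h0 : ξ 0 with _ | _
      · rw [← cons_tail' h0]
        simp only [Bool.not_false, yInv_zero, y_zero_zero]
        rcases n with _ | n
        · rfl
        · exact ih n (by omega) false _
      · rcases h1 : tail ξ 0 with _ | _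
        · rw [← cons_tail' h0, ← cons_tail' h1]
          simp only [Bool.not_false, yInv_one_zero, y_zero_one]
          rcases n with _ | _ | n
          · rfl
          · rfl
          · exact ih n (by omega) true _
        · rw [← cons_tail' h0, ← cons_tail' h1]
          simp only [Bool.not_false, yInv_one_one, y_one]
          rcases n with _ | _ | n
          · rfl
          · rfl
          · exact ih n (by omega) false _
    · rcases h0 : ξ 0 with _ | _
      · rcases h1 : tail ξ 0 with _ | _
        · rw [← cons_tail' h0, ← cons_tail' h1]
          simp only [Bool.not_true, y_zero_zero, yInv_zero]
          rcases n with _ | _ | n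
          · rfl
          · rfl
          · exact ih n (by omega) true _
        · rw [← cons_tail' h0, ← cons_tail' h1]
          simp only [Bool.not_true, y_zero_one, yInv_one_zero]
          rcases n with _ | _ | n
          · rfl
          · rfl
          · exact ih n (by omega) false _
      · rw [← cons_tail' h0]
        simp only [Bool.not_true, y_one, yInv_one_one]
        rcases n with _ | n
        · rfl
        · exact ih n (by omega) true _

/-- The bijection `y` of the set of infinite binary sequences. -/
def y : Equiv.Perm Cantor where
  toFun := yFun true
  invFun := yFun false
  left_inv ξ := funext fun n => yFun_yFun n true ξ
  right_inv ξ := funext fun n => yFun_yFun n false ξ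

/-- The map acting as `b η ↦ b g(η)` on the sequences beginning with the digit `b`, and as the
identity on the others. -/
def locFun (b : Bool) (g : Cantor → Cantor) (ξ : Cantor) : Cantor :=
  if ξ 0 = b then cons b (g (tail ξ)) else ξ

theorem locFun_locFun (b : Bool) (g g' : Cantor → Cantor) (h : ∀ ξ, g' (g ξ) = ξ) (ξ : Cantor) :
    locFun b g' (locFun b g ξ) = ξ := by
  by_cases h0 : ξ 0 = b
  · simp [locFun, h0, h, cons_tail' h0]
  · simp [locFun, h0]

/-- The map `locFun b g`, as a bijection. -/
def locDigit (b : Bool) (g : Equiv.Perm Cantor) : Equiv.Perm Cantor where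
  toFun := locFun b g
  invFun := locFun b g.symm
  left_inv := locFun_locFun b g g.symm g.symm_apply_apply
  right_inv := locFun_locFun b g.symm g g.apply_symm_apply

/-- The localization of `g` at the finite sequence `s`: it maps `s η` to `s g(η)`, and fixes every
sequence that does not extend `s`. -/
def loc : List Bool → Equiv.Perm Cantor → Equiv.Perm Cantor
  | [], g => g
  | b :: s, g => locDigit b (loc s g)

theorem loc_prepend (s : List Bool) (g : Equiv.Perm Cantor) (η : Cantor) :
    loc s g (prepend s η) = prepend s (g η) := by
  induction s with
  | nil => rfl
  | cons b s ih =>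
    change locFun b (loc s g) (cons b (prepend s η)) = cons b (prepend s (g η))
    simp [locFun, ih]

theorem loc_of_not_extends (s : List Bool) (g : Equiv.Perm Cantor) (ξ : Cantor)
    (h : ∀ η, ξ ≠ prepend s η) : loc s g ξ = ξ := by
  induction s generalizing ξ with
  | nil => exact absurd rfl (h ξ)
  | cons b s ih =>
    change locFun b (loc s g) ξ = ξ
    by_cases h0 : ξ 0 = b
    · have : loc s g (tail ξ) = tail ξ := by
        refine ih _ fun η hη => h η ?_
        change ξ = cons b (prepend s η)
        rw [← hη, cons_tail' h0]
      simp [locFun, h0, this, cons_tail' h0]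
    · simp [locFun, h0]

/-- The percolating element `y_s`. -/
def yAt (s : List Bool) : Equiv.Perm Cantor := loc s y

/-- Finite rooted binary trees. -/
inductive BinTree : Type
  | leaf : BinTree
  | node : BinTree → BinTree → BinTree

/-- The addresses of the leaves of a tree, from left to right. -/
def BinTree.leaves : BinTree → List (List Bool)
  | .leaf => [[]]
  | .node l r => l.leaves.map (List.cons false) ++ r.leaves.map (List.cons true)

/-- Thompson's group `F` acting on binary sequences: the maps `s_i ξ ↦ t_i ξ` given by two finite
binary trees with the same number of leaves, `s_i` and `t_i` being their `i`-th leaves. -/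
def IsTreeDiagramMap (f : Equiv.Perm Cantor) : Prop :=
  ∃ L R : BinTree,
    List.Forall₂ (fun s t => ∀ ξ, f (prepend s ξ) = prepend t ξ) L.leaves R.leaves

/-- `s ⊂ t`: the sequence `s` is a proper initial segment of `t`. -/
def ProperInit (s t : List Bool) : Prop := s <+: t ∧ s ≠ t

/-- Independence of finite sequences; a sequence is independent of itself. -/
def Indep (s t : List Bool) : Prop := ¬ ProperInit s t ∧ ¬ ProperInit t s

/-- The word `f y_{s₁}^{t₁} ⋯ y_{sₙ}^{tₙ}`, where `L` is the list of the pairs `(sᵢ, tᵢ)`, is a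
standard form. -/
def IsStandardForm (f : Equiv.Perm Cantor) (L : List (List Bool × ℤ)) : Prop :=
  IsTreeDiagramMap f ∧ (∀ p ∈ L, p.2 ≠ 0) ∧
    L.Pairwise fun p q => Indep p.1 q.1 ∨ ProperInit q.1 p.1

/-- The map given by the word `f y_{s₁}^{t₁} ⋯ y_{sₙ}^{tₙ}`. Words act on the right: the leftmost
letter is applied first. -/
def evalWord (f : Equiv.Perm Cantor) (L : List (List Bool × ℤ)) : Equiv.Perm Cantor :=
  L.foldl (fun g p => g.trans (yAt p.1 ^ p.2)) f

/-- The map given by the word `y_{110}^{-t} f_{10} y_{10s₁}^{t₁} ⋯ y_{10sₙ}^{tₙ}`, where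
`t = t₁ + ⋯ + tₙ` and `f_{10}` is the localization of `f` at `10`. -/
def evalImageWord (f : Equiv.Perm Cantor) (L : List (List Bool × ℤ)) : Equiv.Perm Cantor :=
  evalWord ((yAt [true, true, false] ^ (-(L.map Prod.snd).sum)).trans (loc [true, false] f))
    (L.map fun p => (true :: false :: p.1, p.2))

/-! ### The continued fractions model -/

open scoped ENNReal

/-- The `n`-th approximation from below of `φ`, obtained by reading `n` digits. -/
def phiApprox : ℕ → Cantor → ℝ≥0∞
  | 0, _ => 0
  | n + 1, ξ => if ξ 0 then 1 + phiApprox n (tail ξ) else (1 + (phiApprox n (tail ξ))⁻¹)⁻¹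

/-- The map `φ : 2^ℕ → [0,∞]` with `φ(0ξ) = 1/(1 + 1/φ(ξ))` and `φ(1ξ) = 1 + φ(ξ)`. -/
def phi (ξ : Cantor) : ℝ≥0∞ := ⨆ n, phiApprox n ξ

theorem phiApprox_mono_succ (n : ℕ) : ∀ ξ, phiApprox n ξ ≤ phiApprox (n + 1) ξ := by
  induction n with
  | zero => intro ξ; exact zero_le
  | succ n ih =>
    intro ξ
    rw [phiApprox, phiApprox]
    split_ifs
    · gcongr; exact ih _
    · simp only [ENNReal.inv_le_inv]
      gcongr
      exact ih _

theorem phi_eq_iSup_succ (ξ : Cantor) : phi ξ = ⨆ n, phiApprox (n + 1) ξ :=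
  ((monotone_nat_of_le_succ fun n => phiApprox_mono_succ n ξ).iSup_nat_add 1).symm

theorem phi_one (ξ : Cantor) : phi (cons true ξ) = 1 + phi ξ := by
  rw [phi_eq_iSup_succ, phi, ENNReal.add_iSup]
  simp [phiApprox]

theorem phi_zero (ξ : Cantor) : phi (cons false ξ) = (1 + (phi ξ)⁻¹)⁻¹ := by
  rw [phi_eq_iSup_succ, phi, ENNReal.inv_iSup, ENNReal.add_iInf, ENNReal.inv_iInf]
  simp [phiApprox]

/-- The map `Φ : 2^ℕ → ℝ ∪ {∞}` with `Φ(0ξ) = -φ(ξ̃)`, where `ξ̃` is `ξ` with all digits exchanged,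
and `Φ(1ξ) = φ(ξ)`; here `-∞ = ∞`. -/
def Phi (ξ : Cantor) : Circ :=
  if ξ 0 then
    (if phi (tail ξ) = ∞ then OnePoint.infty else (((phi (tail ξ)).toReal : ℝ) : Circ))
  else
    (if phi (fun n => !(tail ξ n)) = ∞ then OnePoint.infty
      else ((-(phi fun n => !(tail ξ n)).toReal : ℝ) : Circ))

/-- The map `w` of binary sequences represents the homeomorphism `h` of the circle: `Φ` is a
semiconjugacy from `w` to `h`. -/
def Represents (w : Equiv.Perm Cantor) (h : Circ ≃ₜ Circ) : Prop := ∀ ξ, Phi (w ξ) = h (Phi ξ)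

end

end LodhaMoore

/-! ### Doubling maps of intervals and localization to the unit interval. -/

namespace LodhaMoore

open Topology Matrix

noncomputable section

/-! ### Increasing homeomorphisms of the line -/

/-! All non-projective generators are built from one family: `double p q`, which doubles the
coordinate `(x - p) / (q - x)` on `[p, q]` and is the identity elsewhere. The map `c` is `double 0
1`, and `s` is `double 0 1 * (double 1 2)⁻¹`, a doubling compensated by a halving on the adjacent
interval. A map that is orientation-preserving projective on `[p, q]` conjugates `double p q` to the
doubling of the image interval (`double_projective`, `mul_double_eq`).

Conjugation by the piecewise projective `shrink` from the line onto `(0, 1)` gives an injective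
homomorphism `squeeze`; in the binary coding this is localization at `10`. It keeps `F` inside `F`
but sends `c` to a single doubling of `[1/2, 2/3]`. The embedding corrects `squeeze h` by the power
`-n` of `double 1 2`, where `n` is the total exponent of `h`. The two factors have disjoint
supports, so they commute and the correction does not affect injectivity. The image lies in `S`: the
corrected image of `c` is a product of two conjugates of `s` that telescopes
(`double_half_mul_mem_S`).

The exponent is well defined by an analytic invariant, the sum over all points of the jump of the
logarithm of the derivative. By the chain rule it is additive under composition. It vanishes on `F`,
because integral projective pieces that meet at a rational point have the same derivative there
(`MobRel.sq_denom_eq`), and it equals `2 log 2` on every doubling (`hasTotalJump_double`).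

For the statement on words, `phi_y` shows that `y` doubles the continued fraction coordinate, so
`y_s` acts as the doubling of the interval coded by `s` (`repPsi_yAt`). Tree diagram maps act as
elements of `F` (`isPW_of_repPsi`). Comparing total jumps then identifies the exponent of `h` with
the sum of the `t_i` (`exponent_eq_sum`), and localization of words matches `squeeze`.

Finally, `squeeze` embeds `BB(1,2)` in `G₀`: the translation goes into `F`, and the two bends go to
doublings, or inverse doublings, of halves of `[0, 1]`, which are conjugates of `c` or of its
inverse. -/

/-- An increasing homeomorphism of the line, extended to the circle by fixing `∞`. -/
def toCirc : (ℝ ≃o ℝ) →* (Circ ≃ₜ Circ) where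
  toFun g := g.toHomeomorph.onePointCongr
  map_one' := by
    ext x
    induction x using OnePoint.rec <;> rfl
  map_mul' g h := by
    ext x
    induction x using OnePoint.rec <;> rfl

@[simp] theorem toCirc_coe (g : ℝ ≃o ℝ) (x : ℝ) : toCirc g (x : Circ) = (g x : ℝ) := rfl

@[simp] theorem toCirc_infty (g : ℝ ≃o ℝ) : toCirc g OnePoint.infty = OnePoint.infty := rfl

theorem toCirc_injective : Function.Injective toCirc := by
  intro g h hgh
  ext x
  have := DFunLike.congr_fun hgh (x : Circ)
  simpa using this

/-! ### Doubling maps of intervals -/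

/-- The map of `[p, q]` that doubles the coordinate `(x - p) / (q - x)`, extended by the identity. -/
def doubleFun (p q x : ℝ) : ℝ :=
  if p < x ∧ x < q then (p * (q - x) + 2 * q * (x - p)) / ((q - x) + 2 * (x - p)) else x

/-- The inverse of `doubleFun p q`. -/
def halveFun (p q x : ℝ) : ℝ :=
  if p < x ∧ x < q then (2 * p * (q - x) + q * (x - p)) / (2 * (q - x) + (x - p)) else x

theorem doubleFun_of_mem {p q x : ℝ} (h : p < x ∧ x < q) :
    doubleFun p q x = (p * (q - x) + 2 * q * (x - p)) / ((q - x) + 2 * (x - p)) := if_pos h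

theorem doubleFun_of_notMem {p q x : ℝ} (h : ¬ (p < x ∧ x < q)) : doubleFun p q x = x := if_neg h

theorem doubleFun_mem {p q x : ℝ} (h : p < x ∧ x < q) :
    p < doubleFun p q x ∧ doubleFun p q x < q := by
  obtain ⟨h1, h2⟩ := h
  rw [doubleFun_of_mem ⟨h1, h2⟩, lt_div_iff₀ (by linarith), div_lt_iff₀ (by linarith)]
  constructor <;> nlinarith [mul_pos (sub_pos.2 h1) (sub_pos.2 (h1.trans h2)),
    mul_pos (sub_pos.2 h2) (sub_pos.2 (h1.trans h2))]

theorem doubleFun_strictMono (p q : ℝ) : StrictMono (doubleFun p q) := by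
  intro u v huv
  by_cases hu : p < u ∧ u < q <;> by_cases hv : p < v ∧ v < q
  · rw [doubleFun_of_mem hu, doubleFun_of_mem hv,
      div_lt_div_iff₀ (by linarith) (by linarith)]
    nlinarith [mul_pos (sub_pos.2 huv) (mul_pos (sub_pos.2 (hu.1.trans hu.2))
      (sub_pos.2 (hu.1.trans hu.2)))]
  · rw [doubleFun_of_notMem hv]
    have := (doubleFun_mem hu).2
    by_contra hc
    exact hv ⟨hu.1.trans huv, by linarith⟩
  · rw [doubleFun_of_notMem hu]
    have := (doubleFun_mem hv).1
    by_contra hc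
    exact hu ⟨by linarith, huv.trans hv.2⟩
  · rwa [doubleFun_of_notMem hu, doubleFun_of_notMem hv]

theorem doubleFun_halveFun (p q : ℝ) : Function.RightInverse (halveFun p q) (doubleFun p q) := by
  intro x
  by_cases hx : p < x ∧ x < q
  · obtain ⟨h1, h2⟩ := hx
    have h3 : p < q := h1.trans h2
    have hd : 0 < 2 * (q - x) + (x - p) := by linarith
    have hm : p < halveFun p q x ∧ halveFun p q x < q := by
      rw [halveFun, if_pos ⟨h1, h2⟩, lt_div_iff₀ hd, div_lt_iff₀ hd]
      constructor <;> nlinarith [mul_pos (sub_pos.2 h1) (sub_pos.2 h3),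
        mul_pos (sub_pos.2 h2) (sub_pos.2 h3)]
    have e1 : q - halveFun p q x = 2 * (q - x) * (q - p) / (2 * (q - x) + (x - p)) := by
      rw [halveFun, if_pos ⟨h1, h2⟩]; field_simp; ring
    have e2 : halveFun p q x - p = (x - p) * (q - p) / (2 * (q - x) + (x - p)) := by
      rw [halveFun, if_pos ⟨h1, h2⟩]; field_simp; ring
    rw [doubleFun_of_mem hm, div_eq_iff (by linarith), e1, e2]
    field_simp
    ring
  · rw [halveFun, if_neg hx, doubleFun_of_notMem hx]

/-- The map `doubleFun p q`, as an increasing homeomorphism of the line. -/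
def double (p q : ℝ) : ℝ ≃o ℝ :=
  (doubleFun_strictMono p q).orderIsoOfRightInverse _ _ (doubleFun_halveFun p q)

theorem double_apply (p q x : ℝ) : double p q x = doubleFun p q x := rfl

theorem double_of_mem {p q x : ℝ} (h : p < x ∧ x < q) :
    double p q x = (p * (q - x) + 2 * q * (x - p)) / ((q - x) + 2 * (x - p)) :=
  doubleFun_of_mem h

theorem double_of_notMem {p q x : ℝ} (h : ¬ (p < x ∧ x < q)) : double p q x = x :=
  doubleFun_of_notMem h

theorem double_of_mem_Icc {p q x : ℝ} (hpq : p < q) (h : x ∈ Set.Icc p q) :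
    double p q x = (p * (q - x) + 2 * q * (x - p)) / ((q - x) + 2 * (x - p)) := by
  by_cases hx : p < x ∧ x < q
  · exact double_of_mem hx
  · rw [double_of_notMem hx, eq_div_iff (by linarith [h.1, h.2])]
    rcases h.1.eq_or_lt with rfl | h1
    · ring
    · rcases h.2.eq_or_lt with rfl | h2
      · ring
      · exact absurd ⟨h1, h2⟩ hx

theorem double_mem_Icc {p q x : ℝ} (h : x ∈ Set.Icc p q) :
    double p q x ∈ Set.Icc p q := by
  have hp : double p q p = p := double_of_notMem (by simp)
  have hq : double p q q = q := double_of_notMem (by simp)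
  constructor
  · exact hp.symm.le.trans ((double p q).monotone h.1)
  · exact ((double p q).monotone h.2).trans hq.le

/-- Doubling maps are natural for projective maps. -/
theorem double_projective {p q a b c d : ℝ} (hpq : p < q) (hdet : 0 < a * d - b * c)
    (hp : 0 < c * p + d) (hq : 0 < c * q + d) {x : ℝ} (hx : x ∈ Set.Icc p q) :
    double ((a * p + b) / (c * p + d)) ((a * q + b) / (c * q + d)) ((a * x + b) / (c * x + d)) =
      (a * double p q x + b) / (c * double p q x + d) := by
  have pos : ∀ z ∈ Set.Icc p q, 0 < c * z + d := by
    intro z hz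
    rcases hz.1.eq_or_lt with rfl | h1
    · exact hp
    -- The denominator is affine in `z`, so positivity at both endpoints gives positivity in
    -- between, and there is no pole on the interval.
    have : (q - p) * (c * z + d) = (q - z) * (c * p + d) + (z - p) * (c * q + d) := by ring
    have h2 : 0 < (q - p) * (c * z + d) := by
      rw [this]
      exact add_pos_of_nonneg_of_pos (mul_nonneg (sub_nonneg.2 hz.2) hp.le)
        (mul_pos (sub_pos.2 h1) hq)
    exact pos_of_mul_pos_right h2 (sub_pos.2 hpq).le
  have hxd := pos x hx
  -- The difference formula gives monotonicity, and it suits the doubling formula, where the point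
  -- enters only through its differences with the endpoints.
  have mono : ∀ u ∈ Set.Icc p q, ∀ v ∈ Set.Icc p q,
      (a * v + b) / (c * v + d) - (a * u + b) / (c * u + d) =
        (a * d - b * c) * (v - u) / ((c * u + d) * (c * v + d)) := by
    intro u hu v hv
    have hu' := (pos u hu).ne'
    have hv' := (pos v hv).ne'
    rw [div_sub_div _ _ hv' hu', div_eq_div_iff (mul_ne_zero hv' hu') (mul_ne_zero hu' hv')]
    ring
  have hpm : p ∈ Set.Icc p q := ⟨le_rfl, hpq.le⟩
  have hqm : q ∈ Set.Icc p q := ⟨hpq.le, le_rfl⟩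
  have nn : ∀ u ∈ Set.Icc p q, ∀ v ∈ Set.Icc p q, u ≤ v →
      (a * u + b) / (c * u + d) ≤ (a * v + b) / (c * v + d) := by
    intro u hu v hv huv
    rw [← sub_nonneg, mono u hu v hv]
    have := pos u hu
    have := pos v hv
    have := sub_nonneg.2 huv
    positivity
  have lt : (a * p + b) / (c * p + d) < (a * q + b) / (c * q + d) := by
    rw [← sub_pos, mono p hpm q hqm]
    have := sub_pos.2 hpq
    positivity
  rw [double_of_mem_Icc lt ⟨nn p hpm x hx hx.1, nn x hx q hqm hx.2⟩,
    div_eq_div_iff ?_ (pos _ (double_mem_Icc hx)).ne', mono x hx q hqm, mono p hpm x hx,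
    double_of_mem_Icc hpq hx]
  · have h1 : (q - x) + 2 * (x - p) ≠ 0 := by linarith [hx.1, hx.2]
    have hp' := hp.ne'
    have hq' := hq.ne'
    have hx' := hxd.ne'
    generalize hP : c * p + d = P at *
    generalize hQ : c * q + d = Q at *
    generalize hX : c * x + d = X at *
    generalize hW : q - x + 2 * (x - p) = W at *
    field_simp
    subst hP hQ hX hW
    ring
  · have := nn p hpm x hx hx.1
    have := nn x hx q hqm hx.2
    intro h
    linarith

/-- Only the behaviour of `g` on `[p, q]` matters, since both sides are supported on the
corresponding intervals; `a b c d` are the coefficients of that one projective piece. -/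
theorem mul_double_eq {g : ℝ ≃o ℝ} {p q : ℝ} (a b c d : ℝ) (hpq : p < q)
    (hdet : 0 < a * d - b * c) (hp : 0 < c * p + d) (hq : 0 < c * q + d)
    (hg : ∀ x ∈ Set.Icc p q, g x = (a * x + b) / (c * x + d)) :
    g * double p q * g⁻¹ = double (g p) (g q) := by
  rw [mul_inv_eq_iff_eq_mul]
  ext x
  change g (double p q x) = double (g p) (g q) (g x)
  by_cases hx : x ∈ Set.Icc p q
  · rw [hg _ (double_mem_Icc hx), hg _ hx, hg p ⟨le_rfl, hpq.le⟩, hg q ⟨hpq.le, le_rfl⟩,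
      double_projective hpq hdet hp hq hx]
  · rw [double_of_notMem fun h => hx ⟨h.1.le, h.2.le⟩, double_of_notMem]
    simp only [OrderIso.lt_iff_lt]
    exact fun h => hx ⟨h.1.le, h.2.le⟩

/-! ### Localization to the unit interval -/

/-- The piecewise projective homeomorphism from the line onto `(0, 1)`. -/
def shrink (t : ℝ) : ℝ := if t ≤ 0 then 1 / (2 - t) else (1 + t) / (2 + t)

/-- The inverse of `shrink`. -/
def stretch (x : ℝ) : ℝ := if x ≤ 1 / 2 then 2 - 1 / x else (2 * x - 1) / (1 - x)

theorem shrink_of_nonpos {t : ℝ} (h : t ≤ 0) : shrink t = 1 / (2 - t) := if_pos h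

theorem shrink_of_nonneg {t : ℝ} (h : 0 ≤ t) : shrink t = (1 + t) / (2 + t) := by
  rcases h.eq_or_lt with rfl | h
  · norm_num [shrink]
  · exact if_neg (not_le.2 h)

theorem shrink_pos (t : ℝ) : 0 < shrink t := by
  rcases le_total t 0 with h | h
  · rw [shrink_of_nonpos h]; have : 0 < 2 - t := by linarith
    positivity
  · rw [shrink_of_nonneg h]; positivity

theorem shrink_lt_one (t : ℝ) : shrink t < 1 := by
  rcases le_total t 0 with h | h
  · rw [shrink_of_nonpos h, div_lt_one (by linarith)]; linarith
  · rw [shrink_of_nonneg h, div_lt_one (by linarith)]; linarith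

theorem stretch_of_le {x : ℝ} (h : x ≤ 1 / 2) : stretch x = 2 - 1 / x := if_pos h

theorem stretch_of_ge {x : ℝ} (h : 1 / 2 ≤ x) : stretch x = (2 * x - 1) / (1 - x) := by
  rcases h.eq_or_lt with rfl | h
  · norm_num [stretch]
  · exact if_neg (not_le.2 h)

theorem stretch_shrink (t : ℝ) : stretch (shrink t) = t := by
  rcases le_total t 0 with h | h
  · have h2 : 0 < 2 - t := by linarith
    rw [shrink_of_nonpos h, stretch_of_le]
    · field_simp; ring
    · rw [div_le_div_iff₀ h2 two_pos]; linarith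
  · rw [shrink_of_nonneg h, stretch_of_ge]
    · field_simp; ring
    · rw [div_le_div_iff₀ two_pos (by linarith)]; linarith

theorem shrink_stretch {x : ℝ} (h : 0 < x ∧ x < 1) : shrink (stretch x) = x := by
  obtain ⟨h0, h1⟩ := h
  rcases le_total x (1 / 2) with h | h
  · rw [stretch_of_le h, shrink_of_nonpos]
    · field_simp; ring
    · rw [sub_nonpos, le_div_iff₀ h0]; linarith
  · have h2 : 0 < 1 - x := by linarith
    rw [stretch_of_ge h, shrink_of_nonneg]
    · have : (2 + (2 * x - 1) / (1 - x)) ≠ 0 := by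
        have : 0 ≤ (2 * x - 1) / (1 - x) := div_nonneg (by linarith) h2.le
        positivity
      rw [div_eq_iff this]
      field_simp; ring
    · exact div_nonneg (by linarith) h2.le

theorem shrink_strictMono : StrictMono shrink := by
  intro u v huv
  rcases le_total u 0 with hu | hu <;> rcases le_total v 0 with hv | hv
  · rw [shrink_of_nonpos hu, shrink_of_nonpos hv, div_lt_div_iff₀ (by linarith) (by linarith)]
    linarith
  · rw [shrink_of_nonpos hu, shrink_of_nonneg hv, div_lt_div_iff₀ (by linarith) (by linarith)]
    nlinarith
  · linarith
  · rw [shrink_of_nonneg hu, shrink_of_nonneg hv, div_lt_div_iff₀ (by linarith) (by linarith)]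
    nlinarith

/-- The conjugate of `g` by `shrink`, extended by the identity. -/
def squeezeFun (g : ℝ ≃o ℝ) (x : ℝ) : ℝ := if 0 < x ∧ x < 1 then shrink (g (stretch x)) else x

theorem squeezeFun_shrink (g : ℝ ≃o ℝ) (t : ℝ) : squeezeFun g (shrink t) = shrink (g t) := by
  rw [squeezeFun, if_pos ⟨shrink_pos t, shrink_lt_one t⟩, stretch_shrink]

theorem squeezeFun_of_notMem (g : ℝ ≃o ℝ) {x : ℝ} (h : ¬ (0 < x ∧ x < 1)) :
    squeezeFun g x = x := if_neg h

theorem squeezeFun_mul (g h : ℝ ≃o ℝ) (x : ℝ) :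
    squeezeFun (g * h) x = squeezeFun g (squeezeFun h x) := by
  by_cases hx : 0 < x ∧ x < 1
  · rw [← shrink_stretch hx]
    simp only [squeezeFun_shrink]
    rfl
  · simp only [squeezeFun_of_notMem _ hx]

theorem squeezeFun_one (x : ℝ) : squeezeFun 1 x = x := by
  by_cases hx : 0 < x ∧ x < 1
  · rw [← shrink_stretch hx, squeezeFun_shrink]; rfl
  · exact squeezeFun_of_notMem _ hx

theorem squeezeFun_strictMono (g : ℝ ≃o ℝ) : StrictMono (squeezeFun g) := by
  intro u v huv
  have mem : ∀ x, 0 < x ∧ x < 1 → 0 < squeezeFun g x ∧ squeezeFun g x < 1 := by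
    intro x hx
    rw [← shrink_stretch hx, squeezeFun_shrink]
    exact ⟨shrink_pos _, shrink_lt_one _⟩
  by_cases hu : 0 < u ∧ u < 1 <;> by_cases hv : 0 < v ∧ v < 1
  · rw [← shrink_stretch hu, ← shrink_stretch hv] at huv ⊢
    rw [squeezeFun_shrink, squeezeFun_shrink]
    exact shrink_strictMono (g.strictMono (shrink_strictMono.lt_iff_lt.1 huv))
  · rw [squeezeFun_of_notMem _ hv]
    have := (mem u hu).2
    by_contra hc
    exact hv ⟨hu.1.trans huv, by linarith⟩
  · rw [squeezeFun_of_notMem _ hu]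
    have := (mem v hv).1
    by_contra hc
    exact hu ⟨by linarith, huv.trans hv.2⟩
  · rwa [squeezeFun_of_notMem _ hu, squeezeFun_of_notMem _ hv]

/-- Localization of increasing homeomorphisms of the line to the interval `(0, 1)`. -/
def squeeze : (ℝ ≃o ℝ) →* (ℝ ≃o ℝ) where
  toFun g := (squeezeFun_strictMono g).orderIsoOfRightInverse _ (squeezeFun g⁻¹) fun x => by
    rw [← squeezeFun_mul, mul_inv_cancel, squeezeFun_one]
  map_one' := by ext x; exact squeezeFun_one x
  map_mul' g h := by ext x; exact squeezeFun_mul g h x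

@[simp] theorem squeeze_shrink (g : ℝ ≃o ℝ) (t : ℝ) : squeeze g (shrink t) = shrink (g t) :=
  squeezeFun_shrink g t

theorem squeeze_of_notMem (g : ℝ ≃o ℝ) {x : ℝ} (h : ¬ (0 < x ∧ x < 1)) : squeeze g x = x :=
  squeezeFun_of_notMem g h

/-- A homeomorphism that is the identity outside `(0, 1)` is determined by its values at the
points `shrink t`. -/
theorem squeeze_eq {g k : ℝ ≃o ℝ} (h0 : ∀ x, ¬ (0 < x ∧ x < 1) → k x = x)
    (h1 : ∀ t, k (shrink t) = shrink (g t)) : squeeze g = k := by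
  ext x
  by_cases hx : 0 < x ∧ x < 1
  · rw [← shrink_stretch hx, squeeze_shrink, h1]
  · rw [h0 x hx, squeeze_of_notMem g hx]

/-- The supports lie in the disjoint intervals `(0, 1)` and `(1, 2)`. -/
theorem commute_squeeze_double (g : ℝ ≃o ℝ) : Commute (squeeze g) (double 1 2) := by
  ext x
  change squeeze g (double 1 2 x) = double 1 2 (squeeze g x)
  by_cases hx : 0 < x ∧ x < 1
  · have : squeeze g x < 1 := by
      rw [← shrink_stretch hx, squeeze_shrink]; exact shrink_lt_one _
    rw [double_of_notMem fun h => by linarith [h.1, hx.2],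
      double_of_notMem fun h => by linarith [h.1]]
  · rw [squeeze_of_notMem g hx]
    apply squeeze_of_notMem
    by_cases h2 : 1 < x ∧ x < 2
    · have := doubleFun_mem h2
      rw [double_apply]
      exact fun h => by linarith [this.1, h.2]
    · rwa [double_of_notMem h2]

theorem squeeze_injective : Function.Injective squeeze := by
  intro g h hgh
  ext t
  apply shrink_strictMono.injective
  rw [← squeeze_shrink, ← squeeze_shrink, hgh]

/-- On `[0, 1]` the map `shrink` is a single projective map, with `shrink 0 = 1/2` and `shrink 1 =
2/3`, so naturality of doubling applies. -/
theorem squeeze_double : squeeze (double 0 1) = double (1 / 2) (2 / 3) := by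
  apply squeeze_eq
  · intro x hx
    apply double_of_notMem
    exact fun h => hx ⟨by linarith [h.1], by linarith [h.2]⟩
  · intro t
    by_cases ht : t ∈ Set.Icc (0 : ℝ) 1
    · have := double_projective (p := 0) (q := 1) (a := 1) (b := 1) (c := 1) (d := 2) one_pos
        (by norm_num) (by norm_num) (by norm_num) ht
      rw [shrink_of_nonneg ht.1, shrink_of_nonneg (double_mem_Icc ht).1]
      norm_num at this ⊢
      simpa only [add_comm] using this
    · rw [double_of_notMem fun h => ht ⟨h.1.le, h.2.le⟩, double_of_notMem]
      have e1 : (1 / 2 : ℝ) = shrink 0 := by norm_num [shrink]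
      have e2 : (2 / 3 : ℝ) = shrink 1 := by norm_num [shrink]
      rw [e1, e2, shrink_strictMono.lt_iff_lt, shrink_strictMono.lt_iff_lt]
      exact fun h => ht ⟨h.1.le, h.2.le⟩

/-- The map equal to `p t` for `t ≤ 0` and to `q t` for `t ≥ 0`. -/
def bend (p q : ℝ) (hp : 0 < p) (hq : 0 < q) : ℝ ≃o ℝ :=
  (bendFun_strictMono hp hq).orderIsoOfSurjective _ (bendFun_surjective hp hq)

theorem bend_apply {p q : ℝ} (hp : 0 < p) (hq : 0 < q) (t : ℝ) :
    bend p q hp hq t = if t ≤ 0 then p * t else q * t := rfl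

/-- Under `shrink` the half-line `t ≥ 0` becomes `[1/2, 1)`, on which the coordinate being doubled
is a constant multiple of `t`. One endpoint comes from `∞`, outside the scope of
`double_projective`, so the formula is checked directly. -/
theorem squeeze_bend_one_two :
    squeeze (bend 1 2 one_pos two_pos) = double (1 / 2) 1 := by
  apply squeeze_eq
  · intro x hx
    apply double_of_notMem
    exact fun h => hx ⟨by linarith [h.1], h.2⟩
  · intro t
    rw [bend_apply]
    split_ifs with h
    · rw [one_mul, double_of_notMem]
      have e1 : (1 / 2 : ℝ) = shrink 0 := by norm_num [shrink]
      rw [e1, shrink_strictMono.lt_iff_lt]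
      exact fun h' => by linarith [h'.1]
    · have h : 0 < t := not_le.1 h
      have e1 : (1 / 2 : ℝ) = shrink 0 := by norm_num [shrink]
      rw [double_of_mem ⟨by rw [e1, shrink_strictMono.lt_iff_lt]; exact h, shrink_lt_one t⟩,
        shrink_of_nonneg h.le, shrink_of_nonneg (by linarith)]
      rw [div_eq_div_iff _ (by positivity)]
      · field_simp
        ring
      · have : 1 - (1 + t) / (2 + t) + 2 * ((1 + t) / (2 + t) - 1 / 2) = (1 + t) / (2 + t) := by
          ring
        rw [this]; positivity

/-- On `[0, 1/2]` the coordinate of `shrink t` is `-2 / t`, so doubling `t` halves it; this is why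
an inverse appears. -/
theorem squeeze_bend_two_one :
    squeeze (bend 2 1 two_pos one_pos) = (double 0 (1 / 2))⁻¹ := by
  rw [← inv_eq_iff_eq_inv, ← map_inv]
  apply squeeze_eq
  · intro x hx
    apply double_of_notMem
    exact fun h => hx ⟨h.1, by linarith [h.2]⟩
  · intro t
    -- Writing `t` as a value of the bend lets the inverse bend be evaluated without a formula for
    -- it.
    obtain ⟨u, rfl⟩ := (bend 2 1 two_pos one_pos).surjective t
    have : (bend 2 1 two_pos one_pos)⁻¹ (bend 2 1 two_pos one_pos u) = u :=
      (bend 2 1 two_pos one_pos).symm_apply_apply u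
    have e1 : (1 / 2 : ℝ) = shrink 0 := by norm_num [shrink]
    rw [this, bend_apply]
    split_ifs with h
    · rcases h.eq_or_lt with rfl | h
      · rw [double_of_notMem]
        · simp
        · rw [mul_zero, ← e1]; norm_num
      rw [double_of_mem ⟨shrink_pos _, by rw [e1, shrink_strictMono.lt_iff_lt]; linarith⟩,
        shrink_of_nonpos h.le, shrink_of_nonpos (by linarith)]
      have : 0 < 2 - u := by linarith
      have : 0 < 2 - 2 * u := by linarith
      have : 1 - u ≠ 0 := by linarith
      rw [div_eq_div_iff _ (by positivity)]
      · field_simp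
        ring
      · have : 1 / 2 - 1 / (2 - 2 * u) + 2 * (1 / (2 - 2 * u) - 0)
          = 1 / 2 + 1 / (2 - 2 * u) := by ring
        rw [this]; positivity
    · rw [one_mul, double_of_notMem]
      rw [e1, shrink_strictMono.lt_iff_lt]
      exact fun h' => h h'.2.le

theorem toCirc_double_zero_one : toCirc (double 0 1) = cMap := by
  ext x
  induction x using OnePoint.rec with
  | infty => rfl
  | coe x =>
    change ((double 0 1 x : ℝ) : Circ) = ((cFun x : ℝ) : Circ)
    congr 1
    unfold cFun
    split_ifs with h h'
    · exact double_of_notMem fun h' => by linarith [h'.1]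
    · rw [double_of_mem_Icc one_pos ⟨by linarith, h'⟩]
      congr 1 <;> ring
    · exact double_of_notMem fun h'' => by linarith [h''.2]

/-- On `[1, 2]` the formula `2 / (3 - t)` halves the coordinate `(t - 1) / (2 - t)`. -/
theorem toCirc_double_sMap : toCirc (double 0 1 * (double 1 2)⁻¹) = sMap := by
  rw [map_mul, map_inv, mul_inv_eq_iff_eq_mul]
  ext x
  induction x using OnePoint.rec with
  | infty => rfl
  | coe x =>
    change ((double 0 1 x : ℝ) : Circ) = ((sFun (double 1 2 x) : ℝ) : Circ)
    congr 1
    by_cases h : x ≤ 1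
    · rw [double_of_notMem (q := 2) fun h' => by linarith [h'.1]]
      unfold sFun
      split_ifs with h'
      · exact double_of_notMem fun h'' => by linarith [h''.1]
      · rw [double_of_mem_Icc one_pos ⟨by linarith, h⟩]
        congr 1 <;> ring
    · rw [double_of_notMem fun h' => by linarith [h'.2]]
      by_cases h2 : x < 2
      · have hm := doubleFun_mem (p := 1) (q := 2) ⟨not_le.1 h, h2⟩
        rw [← double_apply] at hm
        rw [sFun, if_neg (by linarith), if_neg (by linarith), if_pos hm.2.le, eq_div_iff
          (by linarith), double_of_mem ⟨not_le.1 h, h2⟩]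
        have : 0 < 2 - x + 2 * (x - 1) := by linarith
        field_simp
        ring
      · rw [double_of_notMem fun h' => h2 h'.2]
        rcases (not_lt.1 h2).eq_or_lt with rfl | h2
        · norm_num [sFun]
        · rw [sFun, if_neg (by linarith), if_neg h, if_neg (not_le.2 h2)]

end

end LodhaMoore

/-! ### Piecewise projective maps and the jump of the logarithm of the derivative. -/

namespace LodhaMoore

open Topology Matrix

noncomputable section

/-! ### Local behaviour of piecewise projective maps -/

/-- `y` is the image of `x` under the fractional linear transformation `A`. -/
def MobRel (A : SpecialLinearGroup (Fin 2) ℤ) (x y : ℝ) : Prop :=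
  y * ((A 1 0 : ℤ) * x + (A 1 1 : ℤ)) = (A 0 0 : ℤ) * x + (A 0 1 : ℤ)

theorem det_eq_one (A : SpecialLinearGroup (Fin 2) ℤ) : A 0 0 * A 1 1 - A 0 1 * A 1 0 = 1 := by
  have := A.det_coe
  rwa [Matrix.det_fin_two] at this

theorem det_eq_one_real (A : SpecialLinearGroup (Fin 2) ℤ) :
    ((A 0 0 : ℤ) : ℝ) * (A 1 1 : ℤ) - (A 0 1 : ℤ) * (A 1 0 : ℤ) = 1 := by
  exact_mod_cast det_eq_one A

/-- The matrix with rows `(a, b)` and `(c, d)`. -/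
def slMk (a b c d : ℤ) (h : a * d - b * c = 1) : SpecialLinearGroup (Fin 2) ℤ :=
  ⟨!![a, b; c, d], by rw [Matrix.det_fin_two_of, h]⟩

theorem mobRel_slMk {a b c d : ℤ} {h : a * d - b * c = 1} {x y : ℝ} :
    MobRel (slMk a b c d h) x y ↔ y * (c * x + d) = a * x + b := Iff.rfl

/-- In the division-free relation a zero denominator would force a zero numerator, against
determinant one. So the relation excludes poles by itself. -/
theorem MobRel.denom_ne_zero {A : SpecialLinearGroup (Fin 2) ℤ} {x y : ℝ} (h : MobRel A x y) :
    ((A 1 0 : ℤ) : ℝ) * x + (A 1 1 : ℤ) ≠ 0 := by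
  intro h0
  have h1 := det_eq_one_real A
  unfold MobRel at h
  rw [h0, mul_zero] at h
  have h2 : ((A 0 0 : ℤ) : ℝ) * (A 1 1 : ℤ) - (A 0 1 : ℤ) * (A 1 0 : ℤ) = 0 := by
    linear_combination ((A 0 0 : ℤ) : ℝ) * h0 + ((A 1 0 : ℤ) : ℝ) * h
  linarith

theorem MobRel.eq_div {A : SpecialLinearGroup (Fin 2) ℤ} {x y : ℝ} (h : MobRel A x y) :
    y = ((A 0 0 : ℤ) * x + (A 0 1 : ℤ)) / ((A 1 0 : ℤ) * x + (A 1 1 : ℤ)) :=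
  (eq_div_iff h.denom_ne_zero).2 h

theorem MobRel.one (x : ℝ) : MobRel 1 x x := by simp [MobRel]

theorem MobRel.mul {A B : SpecialLinearGroup (Fin 2) ℤ} {x y z : ℝ} (hB : MobRel B y z)
    (hA : MobRel A x y) : MobRel (B * A) x z := by
  have e : ∀ i j, (B * A) i j = B i 0 * A 0 j + B i 1 * A 1 j := by
    intro i j
    exact (Matrix.mul_apply (M := B.1) (N := A.1)).trans (Fin.sum_univ_two _)
  unfold MobRel at *
  rw [e, e, e, e]
  push_cast
  linear_combination ((A 1 0 : ℤ) * x + (A 1 1 : ℤ)) * hB +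
    (((B 0 0 : ℤ) : ℝ) - z * (B 1 0 : ℤ)) * hA

theorem mobius_coe_eq_iff {A : SpecialLinearGroup (Fin 2) ℤ} {x y : ℝ} :
    (y : Circ) = mobius A x ↔ MobRel A x y := by
  rw [mobius, OnePoint.smul_some_eq_ite]
  have e : ∀ i j, (((SpecialLinearGroup.map (Int.castRingHom ℝ) A :
    SpecialLinearGroup (Fin 2) ℝ) : GL (Fin 2) ℝ) : Matrix (Fin 2) (Fin 2) ℝ) i j = (A i j : ℤ) := by
    intro i j
    rfl
  simp only [e]
  split_ifs with h
  · simp only [OnePoint.coe_ne_infty, false_iff]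
    exact fun h' => h'.denom_ne_zero h
  · rw [OnePoint.coe_eq_coe, MobRel, eq_div_iff h]

/-- Near `x`, the function `f` agrees with an element of `PSL₂(ℤ)`. -/
def LocMob (f : ℝ → ℝ) (x : ℝ) : Prop :=
  ∃ A : SpecialLinearGroup (Fin 2) ℤ, ∀ᶠ y in 𝓝 x, MobRel A y (f y)

theorem hasDerivAt_projective {a b c d x : ℝ} (h : c * x + d ≠ 0) :
    HasDerivAt (fun y => (a * y + b) / (c * y + d)) ((a * d - b * c) / (c * x + d) ^ 2) x := by
  have h1 : HasDerivAt (fun y => a * y + b) a x := by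
    simpa using ((hasDerivAt_id x).const_mul a).add_const b
  have h2 : HasDerivAt (fun y => c * y + d) c x := by
    simpa using ((hasDerivAt_id x).const_mul c).add_const d
  exact (h1.div h2 h).congr_deriv (by ring)

theorem hasDerivWithinAt_of_mobRel {A : SpecialLinearGroup (Fin 2) ℤ} {f : ℝ → ℝ} {s : Set ℝ}
    {x : ℝ} (hx : MobRel A x (f x)) (h : ∀ᶠ y in 𝓝[s] x, MobRel A y (f y)) :
    HasDerivWithinAt f (1 / ((A 1 0 : ℤ) * x + (A 1 1 : ℤ)) ^ 2) s x := by
  have := (hasDerivAt_projective (a := (A 0 0 : ℤ)) (b := (A 0 1 : ℤ))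
    hx.denom_ne_zero).hasDerivWithinAt (s := s)
  rw [det_eq_one_real] at this
  exact this.congr_of_eventuallyEq (h.mono fun y hy => hy.eq_div) hx.eq_div

theorem LocMob.hasDerivAt {f : ℝ → ℝ} {x : ℝ} (h : LocMob f x) : ∃ r > 0, HasDerivAt f r x := by
  obtain ⟨A, hA⟩ := h
  have hx := hA.self_of_nhds
  have := hasDerivWithinAt_of_mobRel (s := Set.univ) hx (by rwa [nhdsWithin_univ])
  rw [hasDerivWithinAt_univ] at this
  have h0 := hx.denom_ne_zero
  exact ⟨_, by positivity, this⟩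

theorem LocMob.comp {f g : ℝ → ℝ} {x : ℝ} (hg : LocMob g (f x)) (hf : LocMob f x) :
    LocMob (fun y => g (f y)) x := by
  obtain ⟨r, -, hr⟩ := hf.hasDerivAt
  obtain ⟨A, hA⟩ := hf
  obtain ⟨B, hB⟩ := hg
  refine ⟨B * A, ?_⟩
  filter_upwards [hA, hr.continuousAt.eventually hB] with y h1 h2 using h2.mul h1

theorem LocMob.congr {f g : ℝ → ℝ} {x : ℝ} (hf : LocMob f x) (h : g =ᶠ[𝓝 x] f) : LocMob g x := by
  obtain ⟨A, hA⟩ := hf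
  refine ⟨A, ?_⟩
  filter_upwards [hA, h] with y h1 h2
  rwa [h2]

/-- The piecewise `PSL₂(ℤ)` homeomorphisms of the line, with finitely many breakpoints, all
rational. -/
def IsPW (g : ℝ ≃o ℝ) : Prop :=
  ∃ B : Set ℝ, B.Finite ∧ B ⊆ Set.range ((↑) : ℚ → ℝ) ∧ ∀ x ∉ B, LocMob g x

theorem toCirc_mem_thompsonT_iff {g : ℝ ≃o ℝ} : toCirc g ∈ thompsonT ↔ IsPW g := by
  constructor
  · rintro ⟨B, hB, hr, h⟩
    refine ⟨(↑) ⁻¹' B, hB.preimage OnePoint.coe_injective.injOn, ?_, ?_⟩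
    · intro x hx
      rcases hr hx with h | ⟨q, hq⟩
      · exact absurd h (OnePoint.coe_ne_infty x)
      · exact ⟨q, OnePoint.coe_injective hq⟩
    · intro x hx
      obtain ⟨A, hA⟩ := h x hx
      refine ⟨A, ?_⟩
      rw [OnePoint.nhds_coe_eq, Filter.eventually_map] at hA
      filter_upwards [hA] with y hy
      rwa [toCirc_coe, mobius_coe_eq_iff] at hy
  · rintro ⟨B, hB, hr, h⟩
    refine ⟨insert OnePoint.infty ((↑) '' B), (hB.image _).insert _, ?_, ?_⟩
    · apply Set.insert_subset_insert
      rintro _ ⟨x, hx, rfl⟩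
      obtain ⟨q, rfl⟩ := hr hx
      exact ⟨q, rfl⟩
    · intro x hx
      induction x using OnePoint.rec with
      | infty => simp at hx
      | coe x =>
        obtain ⟨A, hA⟩ := h x fun hxB => hx (Or.inr ⟨x, hxB, rfl⟩)
        refine ⟨A, ?_⟩
        rw [OnePoint.nhds_coe_eq, Filter.eventually_map]
        filter_upwards [hA] with y hy
        rwa [toCirc_coe, mobius_coe_eq_iff]

theorem toCirc_mem_thompsonF {g : ℝ ≃o ℝ} (h : IsPW g) : toCirc g ∈ thompsonF :=
  ⟨toCirc_mem_thompsonT_iff.2 h, rfl⟩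

/-- The definition of `T` does not mention orientation. A homeomorphism fixing `∞` restricts to a
monotone bijection of the line, and at a point off the finite set of breakpoints its derivative is
`1 / (c x + d) ^ 2 > 0`, which rules out a decreasing one. -/
theorem exists_toCirc_of_mem_thompsonF {h : Circ ≃ₜ Circ} (hF : h ∈ thompsonF) :
    ∃ g : ℝ ≃o ℝ, toCirc g = h ∧ IsPW g := by
  obtain ⟨hT, hinf⟩ := hF
  have ex : ∀ x : ℝ, ∃ y : ℝ, (y : Circ) = h x := by
    intro x
    rw [← OnePoint.ne_infty_iff_exists, ← hinf]
    exact h.injective.ne (OnePoint.coe_ne_infty x)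
  choose k hk using ex
  have hcont : Continuous k := by
    rw [OnePoint.isOpenEmbedding_coe.isEmbedding.continuous_iff]
    have : ((↑) : ℝ → Circ) ∘ k = h ∘ (↑) := funext hk
    rw [this]
    exact h.continuous.comp OnePoint.continuous_coe
  have hinj : Function.Injective k := by
    intro u v huv
    have : h u = h v := by rw [← hk, ← hk, huv]
    exact OnePoint.coe_injective (h.injective this)
  have hsurj : Function.Surjective k := by
    intro v
    obtain ⟨x, hx⟩ := h.surjective v
    induction x using OnePoint.rec with
    | infty => rw [hinf] at hx; exact absurd hx.symm (OnePoint.coe_ne_infty v)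
    | coe x => exact ⟨x, OnePoint.coe_injective (by rw [hk, hx])⟩
  have hmono : StrictMono k := by
    refine (hcont.strictMono_of_inj hinj).resolve_right fun hanti => ?_
    obtain ⟨B, hB, -, hloc⟩ := hT
    obtain ⟨x, hx⟩ := (hB.preimage OnePoint.coe_injective.injOn : ((↑) ⁻¹' B : Set ℝ).Finite).exists_notMem
    obtain ⟨A, hA⟩ := hloc x hx
    rw [OnePoint.nhds_coe_eq, Filter.eventually_map] at hA
    obtain ⟨r, hr, hd⟩ : ∃ r > 0, HasDerivAt k r x := by
      apply LocMob.hasDerivAt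
      refine ⟨A, ?_⟩
      filter_upwards [hA] with y hy
      rwa [← hk, mobius_coe_eq_iff] at hy
    have := hanti.antitone.deriv_nonpos (x := x)
    rw [hd.deriv] at this
    linarith
  let g : ℝ ≃o ℝ := hmono.orderIsoOfSurjective k hsurj
  have hg : toCirc g = h := by
    ext x
    induction x using OnePoint.rec with
    | infty => exact hinf.symm
    | coe x => exact hk x
  exact ⟨g, hg, toCirc_mem_thompsonT_iff.1 (hg ▸ hT)⟩

/-- Two matrices that describe the same function near one point satisfy a quadratic identity on an
interval. Its coefficients therefore agree, and the two relations agree everywhere. -/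
theorem MobRel.congr {A B : SpecialLinearGroup (Fin 2) ℤ} {f : ℝ → ℝ} {x : ℝ}
    (hA : ∀ᶠ y in 𝓝 x, MobRel A y (f y)) (hB : ∀ᶠ y in 𝓝 x, MobRel B y (f y)) {u v : ℝ}
    (h : MobRel A u v) : MobRel B u v := by
  obtain ⟨ε, hε, hb⟩ := Metric.eventually_nhds_iff.1 (hA.and hB)
  have key : ∀ y, dist y x < ε → ((A 0 0 : ℤ) * y + (A 0 1 : ℤ)) * ((B 1 0 : ℤ) * y + (B 1 1 : ℤ)) =
      ((B 0 0 : ℤ) * y + (B 0 1 : ℤ)) * ((A 1 0 : ℤ) * y + ((A 1 1 : ℤ) : ℝ)) := by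
    intro y hy
    obtain ⟨h1, h2⟩ := hb hy
    unfold MobRel at h1 h2
    rw [← h1, ← h2]
    ring
  -- Three points determine a quadratic polynomial: the second difference gives the leading
  -- coefficient, then the first difference and the value give the others.
  have k0 := key x (by simpa)
  have k1 := key (x + ε / 2) (by rw [Real.dist_eq, add_sub_cancel_left, abs_of_pos] <;> linarith)
  have k2 := key (x - ε / 2) (by rw [Real.dist_eq, sub_sub_cancel_left, abs_neg, abs_of_pos] <;> linarith)
  have hd := h.denom_ne_zero
  unfold MobRel at h ⊢
  apply mul_right_cancel₀ hd
  have e2 : ((A 0 0 : ℤ) : ℝ) * (B 1 0 : ℤ) = (B 0 0 : ℤ) * (A 1 0 : ℤ) := by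
    have : ε ^ 2 ≠ 0 := by positivity
    apply mul_right_cancel₀ this
    linear_combination 2 * (k1 + k2 - 2 * k0)
  have e1 : ((A 0 0 : ℤ) : ℝ) * (B 1 1 : ℤ) + (A 0 1 : ℤ) * (B 1 0 : ℤ) =
      (B 0 0 : ℤ) * (A 1 1 : ℤ) + (B 0 1 : ℤ) * (A 1 0 : ℤ) := by
    apply mul_right_cancel₀ hε.ne'
    linear_combination k1 - k2 - 2 * x * ε * e2
  have e0 : ((A 0 1 : ℤ) : ℝ) * (B 1 1 : ℤ) = (B 0 1 : ℤ) * (A 1 1 : ℤ) := by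
    linear_combination k0 - x ^ 2 * e2 - x * e1
  linear_combination ((B 1 0 : ℤ) * u + (B 1 1 : ℤ)) * h + u ^ 2 * e2 + u * e1 + e0

/-- Continuation along a connected set: by `MobRel.congr`, a matrix valid near one point stays valid
near all neighbouring points. -/
theorem exists_mobRel_of_isPreconnected {f : ℝ → ℝ} {s : Set ℝ} (hs : IsPreconnected s)
    (hne : s.Nonempty) (h : ∀ x ∈ s, LocMob f x) :
    ∃ A, ∀ x ∈ s, MobRel A x (f x) := by
  obtain ⟨x₀, hx₀⟩ := hne
  obtain ⟨A, hA⟩ := h x₀ hx₀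
  refine ⟨A, fun x hx => ?_⟩
  have := hs.induction₂' (fun x y => ∀ A, (∀ᶠ u in 𝓝 x, MobRel A u (f u)) →
    ∀ᶠ u in 𝓝 y, MobRel A u (f u)) ?_ ?_ hx₀ hx
  · exact (this A hA).self_of_nhds
  · intro y hy
    obtain ⟨B, hB⟩ := h y hy
    filter_upwards [nhdsWithin_le_nhds hB.eventually_nhds] with z hz
    exact ⟨fun C hC => hz.mono fun u hu => MobRel.congr hB hC hu,
      fun C hC => hB.mono fun u hu => MobRel.congr hz hC hu⟩
  · exact fun _ _ _ _ _ _ h1 h2 C hC => h2 C (h1 C hC)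

/-- Write `q = m / n` in lowest terms. A matrix of determinant one sends `(m, n)` to a coprime pair,
so `c m + d n` is, up to sign, the reduced denominator of `y` and depends on `y` alone. Since the
derivative is `1 / (c q + d) ^ 2`, pieces meeting at a rational point have equal slopes. -/
theorem MobRel.sq_denom_eq {A B : SpecialLinearGroup (Fin 2) ℤ} {q : ℚ} {y : ℝ}
    (hA : MobRel A q y) (hB : MobRel B q y) :
    (((A 1 0 : ℤ) : ℝ) * q + (A 1 1 : ℤ)) ^ 2 = (((B 1 0 : ℤ) : ℝ) * q + (B 1 1 : ℤ)) ^ 2 := by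
  have hn : (q.den : ℝ) ≠ 0 := by exact_mod_cast q.den_nz
  have hq : (q : ℝ) = q.num / q.den := Rat.cast_def q
  have hcop : IsCoprime q.num (q.den : ℤ) := by
    rw [Int.isCoprime_iff_gcd_eq_one]; exact q.reduced
  have cop : ∀ C : SpecialLinearGroup (Fin 2) ℤ,
      IsCoprime (C 0 0 * q.num + C 0 1 * q.den) (C 1 0 * q.num + C 1 1 * q.den) := by
    intro C
    obtain ⟨u, v, huv⟩ := hcop
    have := det_eq_one C
    exact ⟨u * C 1 1 - v * C 1 0, v * C 0 0 - u * C 0 1, by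
      linear_combination (u * q.num + v * q.den) * this + huv⟩
  have cross : (A 0 0 * q.num + A 0 1 * q.den) * (B 1 0 * q.num + B 1 1 * q.den) =
      (B 0 0 * q.num + B 0 1 * q.den) * (A 1 0 * q.num + A 1 1 * q.den) := by
    unfold MobRel at hA hB
    rw [hq] at hA hB
    field_simp at hA hB
    have : (((A 0 0 * q.num + A 0 1 * q.den) * (B 1 0 * q.num + B 1 1 * q.den) : ℤ) : ℝ) =
      ((B 0 0 * q.num + B 0 1 * q.den) * (A 1 0 * q.num + A 1 1 * q.den) : ℤ) := by
      push_cast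
      linear_combination -((B 1 0 : ℤ) * q.num + (B 1 1 : ℤ) * q.den) * hA +
        ((A 1 0 : ℤ) * q.num + (A 1 1 : ℤ) * q.den) * hB
    exact_mod_cast this
  have d1 : (A 1 0 * q.num + A 1 1 * q.den) ∣ (B 1 0 * q.num + B 1 1 * q.den) :=
    (cop A).symm.dvd_of_dvd_mul_left ⟨_, by rw [cross, mul_comm]⟩
  have d2 : (B 1 0 * q.num + B 1 1 * q.den) ∣ (A 1 0 * q.num + A 1 1 * q.den) :=
    (cop B).symm.dvd_of_dvd_mul_left ⟨_, by rw [← cross, mul_comm]⟩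
  have e := Int.natAbs_eq_natAbs_iff.1 (Nat.dvd_antisymm (Int.natAbs_dvd_natAbs.2 d1)
    (Int.natAbs_dvd_natAbs.2 d2))
  have e2 : (A 1 0 * q.num + A 1 1 * q.den) ^ 2 = (B 1 0 * q.num + B 1 1 * q.den) ^ 2 :=
    sq_eq_sq_iff_eq_or_eq_neg.2 e
  have e3 : (((A 1 0 : ℤ) : ℝ) * q.num + (A 1 1 : ℤ) * q.den) ^ 2 =
    (((B 1 0 : ℤ) : ℝ) * q.num + (B 1 1 : ℤ) * q.den) ^ 2 := by exact_mod_cast e2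
  rw [hq]
  field_simp
  linear_combination e3

/-! ### The total jump of the derivative -/

/-- The logarithms of the right and left derivatives of `g` at `x` differ by `j`. -/
def HasJump (g : ℝ ≃o ℝ) (x j : ℝ) : Prop :=
  ∃ r l : ℝ, 0 < r ∧ 0 < l ∧ HasDerivWithinAt g r (Set.Ioi x) x ∧
    HasDerivWithinAt g l (Set.Iio x) x ∧ Real.log r - Real.log l = j

theorem HasJump.unique {g : ℝ ≃o ℝ} {x j k : ℝ} (hj : HasJump g x j) (hk : HasJump g x k) :
    j = k := by
  obtain ⟨r, l, -, -, hr, hl, rfl⟩ := hj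
  obtain ⟨r', l', -, -, hr', hl', rfl⟩ := hk
  rw [(uniqueDiffWithinAt_Ioi x).eq_deriv _ hr hr', (uniqueDiffWithinAt_Iio x).eq_deriv _ hl hl']

theorem hasJump_zero_of_hasDerivAt {g : ℝ ≃o ℝ} {x r : ℝ} (hr : 0 < r) (h : HasDerivAt g r x) :
    HasJump g x 0 :=
  ⟨r, r, hr, hr, h.hasDerivWithinAt, h.hasDerivWithinAt, sub_self _⟩

/-- The chain rule holds on each side separately, because an increasing map preserves sides. -/
theorem HasJump.mul {g h : ℝ ≃o ℝ} {x j k : ℝ} (hk : HasJump g (h x) k) (hj : HasJump h x j) :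
    HasJump (g * h) x (k + j) := by
  obtain ⟨r, l, hr0, hl0, hr, hl, rfl⟩ := hj
  obtain ⟨r', l', hr0', hl0', hr', hl', rfl⟩ := hk
  refine ⟨r' * r, l' * l, mul_pos hr0' hr0, mul_pos hl0' hl0,
    hr'.comp x hr fun y hy => h.strictMono hy, hl'.comp x hl fun y hy => h.strictMono hy, ?_⟩
  rw [Real.log_mul hr0'.ne' hr0.ne', Real.log_mul hl0'.ne' hl0.ne']
  ring

/-- The slopes of the inverse are the reciprocals of the slopes of `g` at the preimages, and these
converge by continuity of the inverse. -/
theorem hasDerivWithinAt_inv {g : ℝ ≃o ℝ} {x r : ℝ} {s t : Set ℝ} (hr : r ≠ 0)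
    (h : HasDerivWithinAt g r s x) (hst : ∀ y ∈ t, g⁻¹ y ∈ s) :
    HasDerivWithinAt (g⁻¹ : ℝ ≃o ℝ) r⁻¹ t (g x) := by
  have hx : (g⁻¹ : ℝ ≃o ℝ) (g x) = x := g.symm_apply_apply x
  have h1 := (hasDerivWithinAt_iff_tendsto_slope.1 h)
  rw [hasDerivWithinAt_iff_tendsto_slope]
  have h2 : Filter.Tendsto (g⁻¹ : ℝ ≃o ℝ) (𝓝[t \ {g x}] (g x)) (𝓝[s \ {x}] x) := by
    apply tendsto_nhdsWithin_of_tendsto_nhds_of_eventually_within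
    · have := (g⁻¹ : ℝ ≃o ℝ).continuous.tendsto (g x)
      rw [hx] at this
      exact this.mono_left nhdsWithin_le_nhds
    · filter_upwards [self_mem_nhdsWithin] with y hy
      refine ⟨hst y hy.1, fun he => hy.2 ?_⟩
      rw [Set.mem_singleton_iff] at he ⊢
      rw [← he]
      exact (g.apply_symm_apply y).symm
  refine ((h1.comp h2).inv₀ hr).congr fun y => ?_
  have hy : g ((g⁻¹ : ℝ ≃o ℝ) y) = y := g.apply_symm_apply y
  simp only [Function.comp_apply, slope_def_field, hy, hx, inv_div]

theorem HasJump.inv {g : ℝ ≃o ℝ} {x j : ℝ} (h : HasJump g x j) : HasJump g⁻¹ (g x) (-j) := by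
  obtain ⟨r, l, hr0, hl0, hr, hl, rfl⟩ := h
  have hx : (g⁻¹ : ℝ ≃o ℝ) (g x) = x := g.symm_apply_apply x
  refine ⟨r⁻¹, l⁻¹, inv_pos.2 hr0, inv_pos.2 hl0, hasDerivWithinAt_inv hr0.ne' hr ?_,
    hasDerivWithinAt_inv hl0.ne' hl ?_, ?_⟩
  · intro y hy
    have := (g⁻¹ : ℝ ≃o ℝ).strictMono (Set.mem_Ioi.1 hy)
    rwa [hx] at this
  · intro y hy
    have := (g⁻¹ : ℝ ≃o ℝ).strictMono (Set.mem_Iio.1 hy)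
    rwa [hx] at this
  · rw [Real.log_inv, Real.log_inv]; ring

/-- The map `g` has one-sided derivatives everywhere, and the sum of its jumps is `s`. -/
def HasTotalJump (g : ℝ ≃o ℝ) (s : ℝ) : Prop :=
  ∃ j : ℝ → ℝ, (∀ x, HasJump g x (j x)) ∧ j.HasFiniteSupport ∧ ∑ᶠ x, j x = s

theorem HasTotalJump.unique {g : ℝ ≃o ℝ} {s t : ℝ} (hs : HasTotalJump g s)
    (ht : HasTotalJump g t) : s = t := by
  obtain ⟨j, hj, -, rfl⟩ := hs
  obtain ⟨k, hk, -, rfl⟩ := ht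
  rw [funext fun x => (hj x).unique (hk x)]

theorem hasTotalJump_zero {g : ℝ ≃o ℝ} (h : ∀ x, HasJump g x 0) : HasTotalJump g 0 :=
  ⟨fun _ => 0, h, by simp [Function.HasFiniteSupport], by simp⟩

theorem HasTotalJump.one : HasTotalJump 1 0 :=
  hasTotalJump_zero fun x => hasJump_zero_of_hasDerivAt one_pos (hasDerivAt_id x)

/-- The jump of `g * h` at `x` is that of `g` at `h x` plus that of `h` at `x`; in the sum over `x`,
the bijection `h` reindexes the first term. -/
theorem HasTotalJump.mul {g h : ℝ ≃o ℝ} {s t : ℝ} (hs : HasTotalJump g s)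
    (ht : HasTotalJump h t) : HasTotalJump (g * h) (s + t) := by
  obtain ⟨j, hj, fj, rfl⟩ := hs
  obtain ⟨k, hk, fk, rfl⟩ := ht
  have fj' : (fun x => j (h x)).HasFiniteSupport :=
    (fj.preimage h.injective.injOn : (h ⁻¹' Function.support j).Finite)
  refine ⟨fun x => j (h x) + k x, fun x => (hj _).mul (hk x), ?_, ?_⟩
  · exact (fj'.union fk).subset (Function.support_add _ _)
  · rw [finsum_add_distrib fj' fk]
    congr 1
    exact finsum_comp_equiv h.toEquiv

theorem HasTotalJump.inv {g : ℝ ≃o ℝ} {s : ℝ} (hs : HasTotalJump g s) :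
    HasTotalJump g⁻¹ (-s) := by
  obtain ⟨j, hj, fj, rfl⟩ := hs
  have fj' : (fun x => j ((g⁻¹ : ℝ ≃o ℝ) x)).HasFiniteSupport :=
    (fj.preimage (g⁻¹ : ℝ ≃o ℝ).injective.injOn :
      ((g⁻¹ : ℝ ≃o ℝ) ⁻¹' Function.support j).Finite)
  refine ⟨fun x => -j ((g⁻¹ : ℝ ≃o ℝ) x), fun x => ?_, ?_, ?_⟩
  · have := (hj ((g⁻¹ : ℝ ≃o ℝ) x)).inv
    have hx : g ((g⁻¹ : ℝ ≃o ℝ) x) = x := g.apply_symm_apply x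
    rwa [hx] at this
  · exact fj'.subset (by simp [Function.support])
  · rw [finsum_neg_distrib]
    congr 1
    exact finsum_comp_equiv (g⁻¹ : ℝ ≃o ℝ).toEquiv

/-- Every single jump vanishes, since the one-sided derivatives agree even at breakpoints. -/
theorem IsPW.hasTotalJump {g : ℝ ≃o ℝ} (hg : IsPW g) : HasTotalJump g 0 := by
  obtain ⟨B, hB, hr, hloc⟩ := hg
  refine hasTotalJump_zero fun x => ?_
  by_cases hx : x ∈ B
  · obtain ⟨q, rfl⟩ := hr hx
    have hfin : (B \ {(q : ℝ)}).Finite := hB.subset Set.sdiff_subset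
    -- A ball containing no other breakpoint, so that one matrix serves on each side of `q`.
    obtain ⟨ε, hε, hball⟩ := Metric.mem_nhds_iff.1 (hfin.isClosed.isOpen_compl.mem_nhds
      (show (q : ℝ) ∈ (B \ {(q : ℝ)})ᶜ by simp))
    have hnot : ∀ y : ℝ, y ≠ q → |y - q| < ε → LocMob g y := by
      intro y hy hyε
      refine hloc y fun hyB => ?_
      exact hball (show y ∈ Metric.ball (q : ℝ) ε from hyε) ⟨hyB, hy⟩
    obtain ⟨A, hA⟩ := exists_mobRel_of_isPreconnected (f := g)
      (isPreconnected_Ioo (a := (q : ℝ)) (b := q + ε)) (Set.nonempty_Ioo.2 (by linarith))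
      fun y hy => hnot y hy.1.ne' (by rw [abs_lt]; constructor <;> linarith [hy.1, hy.2])
    obtain ⟨C, hC⟩ := exists_mobRel_of_isPreconnected (f := g)
      (isPreconnected_Ioo (a := (q : ℝ) - ε) (b := q)) (Set.nonempty_Ioo.2 (by linarith))
      fun y hy => hnot y hy.2.ne (by rw [abs_lt]; constructor <;> linarith [hy.1, hy.2])
    have evA : ∀ᶠ y in 𝓝[>] (q : ℝ), MobRel A y (g y) := by
      filter_upwards [Ioo_mem_nhdsGT (show (q : ℝ) < q + ε by linarith)] using hA
    have evC : ∀ᶠ y in 𝓝[<] (q : ℝ), MobRel C y (g y) := by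
      filter_upwards [Ioo_mem_nhdsLT (show (q : ℝ) - ε < q by linarith)] using hC
    -- The relation is a polynomial identity in `y` and `g y`, so it passes to the limit at `q`;
    -- hence both one-sided matrices send `q` to `g q`.
    have lim : ∀ (D : SpecialLinearGroup (Fin 2) ℤ) (s : Set ℝ) [(𝓝[s] (q : ℝ)).NeBot],
        (∀ᶠ y in 𝓝[s] (q : ℝ), MobRel D y (g y)) → MobRel D q (g q) := by
      intro D s _ hD
      have c1 : Continuous fun y : ℝ => g y * ((D 1 0 : ℤ) * y + (D 1 1 : ℤ)) :=
        g.continuous.mul (by fun_prop)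
      have c2 : Continuous fun y : ℝ => ((D 0 0 : ℤ) : ℝ) * y + (D 0 1 : ℤ) := by fun_prop
      exact tendsto_nhds_unique_of_eventuallyEq
        ((c1.tendsto (q : ℝ)).mono_left nhdsWithin_le_nhds)
        ((c2.tendsto (q : ℝ)).mono_left nhdsWithin_le_nhds) hD
    have hqA := lim A _ evA
    have hqC := lim C _ evC
    have h1 := hqA.denom_ne_zero
    have h2 := hqC.denom_ne_zero
    refine ⟨_, _, ?_, ?_, hasDerivWithinAt_of_mobRel hqA evA, hasDerivWithinAt_of_mobRel hqC evC, ?_⟩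
    · positivity
    · positivity
    · rw [hqA.sq_denom_eq hqC, sub_self]
  · obtain ⟨r, hr, hd⟩ := (hloc x hx).hasDerivAt
    exact hasJump_zero_of_hasDerivAt hr hd

/-- The right derivative at `p` is `2` and the left derivative at `q` is `1/2`, while the outer ones
are `1`; so each endpoint contributes `log 2`, whatever the interval. -/
theorem hasTotalJump_double {p q : ℝ} (hpq : p < q) :
    HasTotalJump (double p q) (2 * Real.log 2) := by
  have form : ∀ x ∈ Set.Icc p q,
      double p q x = ((2 * q - p) * x + -(p * q)) / (1 * x + (q - 2 * p)) := by
    intro x hx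
    rw [double_of_mem_Icc hpq hx]
    congr 1 <;> ring
  have der : ∀ x ∈ Set.Icc p q,
      HasDerivAt (fun x => ((2 * q - p) * x + -(p * q)) / (1 * x + (q - 2 * p)))
        (2 * (q - p) ^ 2 / (x + (q - 2 * p)) ^ 2) x := by
    intro x hx
    have : 1 * x + (q - 2 * p) ≠ 0 := by linarith [hx.1, hx.2]
    convert hasDerivAt_projective (a := 2 * q - p) (b := -(p * q)) this using 1
    congr 1 <;> ring
  have hp : p ∈ Set.Icc p q := ⟨le_rfl, hpq.le⟩
  have hq : q ∈ Set.Icc p q := ⟨hpq.le, le_rfl⟩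
  have jp : HasJump (double p q) p (Real.log 2) := by
    refine ⟨2, 1, two_pos, one_pos, ?_, ?_, by simp⟩
    · have := (der p hp).hasDerivWithinAt (s := Set.Ioi p)
      have e : 2 * (q - p) ^ 2 / (p + (q - 2 * p)) ^ 2 = 2 := by
        rw [div_eq_iff (pow_ne_zero 2 (by linarith))]; ring
      rw [e] at this
      refine this.congr_of_eventuallyEq ?_ (form p hp)
      filter_upwards [Ioo_mem_nhdsGT hpq] with y hy using form y ⟨hy.1.le, hy.2.le⟩
    · refine (hasDerivWithinAt_id p (Set.Iio p)).congr (fun y hy => ?_) ?_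
      · exact double_of_notMem fun h => lt_asymm h.1 hy
      · exact double_of_notMem fun h => lt_irrefl _ h.1
  have jq : HasJump (double p q) q (Real.log 2) := by
    refine ⟨1, 1 / 2, one_pos, by norm_num, ?_, ?_, by simp⟩
    · refine (hasDerivWithinAt_id q (Set.Ioi q)).congr (fun y hy => ?_) ?_
      · exact double_of_notMem fun h => lt_asymm h.2 hy
      · exact double_of_notMem fun h => lt_irrefl _ h.2
    · have := (der q hq).hasDerivWithinAt (s := Set.Iio q)
      have e : 2 * (q - p) ^ 2 / (q + (q - 2 * p)) ^ 2 = 1 / 2 := by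
        rw [div_eq_div_iff (pow_ne_zero 2 (by linarith)) two_ne_zero]; ring
      rw [e] at this
      refine this.congr_of_eventuallyEq ?_ (form q hq)
      filter_upwards [Ioo_mem_nhdsLT hpq] with y hy using form y ⟨hy.1.le, hy.2.le⟩
  have j0 : ∀ x, x ≠ p → x ≠ q → HasJump (double p q) x 0 := by
    intro x hxp hxq
    by_cases hx : p < x ∧ x < q
    · have hm : x ∈ Set.Icc p q := ⟨hx.1.le, hx.2.le⟩
      refine hasJump_zero_of_hasDerivAt ?_ ((der x hm).congr_of_eventuallyEq ?_)
      · have : 0 < x + (q - 2 * p) := by linarith [hx.1, hx.2]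
        have := sub_pos.2 hpq
        positivity
      · filter_upwards [Ioo_mem_nhds hx.1 hx.2] with y hy using form y ⟨hy.1.le, hy.2.le⟩
    · refine hasJump_zero_of_hasDerivAt one_pos ((hasDerivAt_id x).congr_of_eventuallyEq ?_)
      rcases lt_or_gt_of_ne hxp with h | h
      · filter_upwards [Iio_mem_nhds h] with y hy
        exact double_of_notMem fun h => lt_asymm h.1 hy
      · have h' : q < x := lt_of_le_of_ne (not_lt.1 fun h' => hx ⟨h, h'⟩) hxq.symm
        filter_upwards [Ioi_mem_nhds h'] with y hy
        exact double_of_notMem fun h => lt_asymm h.2 hy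
  classical
  let j : ℝ → ℝ := fun x => if x ∈ ({p, q} : Finset ℝ) then Real.log 2 else 0
  have hsupp : Function.support j ⊆ ({p, q} : Finset ℝ) := by
    intro x hx
    by_contra h
    exact hx (if_neg h)
  refine ⟨j, fun x => ?_, ?_, ?_⟩
  · by_cases hxp : x = p
    · subst hxp; simpa [j] using jp
    · by_cases hxq : x = q
      · subst hxq; simpa [j] using jq
      · simpa [j, hxp, hxq] using j0 x hxp hxq
  · exact (Finset.finite_toSet _).subset hsupp
  · rw [finsum_eq_sum_of_support_subset j hsupp, Finset.sum_pair hpq.ne]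
    simp [j]
    ring

end

end LodhaMoore

/-! ### Membership of generators and the two embeddings. -/

namespace LodhaMoore

open Topology

noncomputable section

/-! ### Two elements of `F` -/

/-- `x + 1`, `(1 + x) / (2 + x)`, `1 / (2 - x)`, `x` on the intervals cut out by `-1, 0, 1`. -/
def pushRightFun (x : ℝ) : ℝ :=
  if x ≤ -1 then x + 1 else if x ≤ 0 then (1 + x) / (2 + x) else if x ≤ 1 then 1 / (2 - x) else x

/-- The inverse of `pushRightFun`. -/
def pushRightInv (v : ℝ) : ℝ :=
  if v ≤ 0 then v - 1 else if v ≤ 1 / 2 then (2 * v - 1) / (1 - v) else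
    if v ≤ 1 then 2 - 1 / v else v

theorem pushRightFun_strictMono : StrictMono pushRightFun := by
  intro u v huv
  have k1 : ∀ w : ℝ, -1 < w → w ≤ 0 → 0 < (1 + w) / (2 + w) ∧ (1 + w) / (2 + w) ≤ 1 / 2 := by
    intro w h0 h1
    rw [div_le_div_iff₀ (by linarith) two_pos]
    exact ⟨div_pos (by linarith) (by linarith), by linarith⟩
  have k2 : ∀ w : ℝ, 0 < w → w ≤ 1 → 1 / 2 < 1 / (2 - w) ∧ 1 / (2 - w) ≤ 1 := by
    intro w h0 h1
    rw [div_lt_div_iff₀ two_pos (by linarith), div_le_one (by linarith)]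
    exact ⟨by linarith, by linarith⟩
  unfold pushRightFun
  split_ifs
  all_goals first
    | linarith
    | linarith [(k1 v (by linarith) (by linarith)).1]
    | linarith [(k2 v (by linarith) (by linarith)).1]
    | linarith [(k1 u (by linarith) (by linarith)).2]
    | linarith [(k2 u (by linarith) (by linarith)).2]
    | linarith [(k1 u (by linarith) (by linarith)).2, (k2 v (by linarith) (by linarith)).1]
    | (rw [div_lt_div_iff₀ (by linarith) (by linarith)]; nlinarith)

theorem pushRightFun_rightInverse : Function.RightInverse pushRightInv pushRightFun := by
  intro v
  unfold pushRightInv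
  split_ifs with h1 h2 h3
  · rw [pushRightFun, if_pos (by linarith)]; ring
  · have h4 : 0 < 1 - v := by linarith
    have a : ¬ (2 * v - 1) / (1 - v) ≤ -1 := by
      rw [not_le, lt_div_iff₀ h4]; linarith
    have b : (2 * v - 1) / (1 - v) ≤ 0 := by
      rw [div_le_iff₀ h4]; linarith
    rw [pushRightFun, if_neg a, if_pos b, div_eq_iff (by linarith)]
    field_simp
    ring
  · have h0 : 0 < v := by linarith
    have a : ¬ 2 - 1 / v ≤ 0 := by
      rw [not_le, sub_pos, div_lt_iff₀ h0]; linarith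
    have b : 2 - 1 / v ≤ 1 := by
      have : 1 ≤ 1 / v := by rw [le_div_iff₀ h0]; linarith
      linarith
    rw [pushRightFun, if_neg (by linarith), if_neg a, if_pos b, sub_sub_cancel, one_div_one_div]
  · rw [pushRightFun, if_neg (by linarith), if_neg (by linarith), if_neg h3]

/-- An element of `F` that maps `[0, 1]` to `[1/2, 1]` and fixes `[1, ∞)`. -/
def pushRight : ℝ ≃o ℝ :=
  pushRightFun_strictMono.orderIsoOfRightInverse _ _ pushRightFun_rightInverse

theorem pushRight_apply (x : ℝ) : pushRight x = pushRightFun x := rfl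

theorem pushRight_of_le {x : ℝ} (h : x ≤ -1) : pushRight x = x + 1 := if_pos h

theorem pushRight_left {x : ℝ} (h : x ∈ Set.Icc (-1 : ℝ) 0) :
    pushRight x = (1 + x) / (2 + x) := by
  rcases h.1.eq_or_lt with rfl | h1
  · norm_num [pushRight_apply, pushRightFun]
  · rw [pushRight_apply, pushRightFun, if_neg (not_le.2 h1), if_pos h.2]

theorem pushRight_right {x : ℝ} (h : x ∈ Set.Icc (0 : ℝ) 1) : pushRight x = 1 / (2 - x) := by
  rcases h.1.eq_or_lt with rfl | h1
  · norm_num [pushRight_apply, pushRightFun]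
  · rw [pushRight_apply, pushRightFun, if_neg (by linarith), if_neg (not_le.2 h1), if_pos h.2]

theorem pushRight_of_ge {x : ℝ} (h : 1 ≤ x) : pushRight x = x := by
  rcases h.eq_or_lt with rfl | h1
  · norm_num [pushRight_apply, pushRightFun]
  · rw [pushRight_apply, pushRightFun, if_neg (by linarith), if_neg (by linarith),
      if_neg (not_le.2 h1)]

/-- An element of `F` that maps `[0, 1]` to `[0, 1/2]` and `[1, 2]` to `[1/2, 1]`. -/
def pushLeft : ℝ ≃o ℝ :=
  -- The conjugate of `pushRight` by the reflection `x ↦ 1 - x`.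
  StrictMono.orderIsoOfRightInverse (fun x => 1 - pushRight (1 - x))
    (fun _ _ h => sub_lt_sub_left (pushRight.strictMono (sub_lt_sub_left h 1)) 1)
    (fun x => 1 - pushRight.symm (1 - x)) fun x => by simp

theorem pushLeft_apply (x : ℝ) : pushLeft x = 1 - pushRight (1 - x) := rfl

theorem pushLeft_left {x : ℝ} (h : x ∈ Set.Icc (0 : ℝ) 1) : pushLeft x = x / (1 + x) := by
  rw [pushLeft_apply, pushRight_right ⟨by linarith [h.2], by linarith [h.1]⟩]
  have : 1 + x ≠ 0 := by linarith [h.1]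
  have e : 2 - (1 - x) = 1 + x := by ring
  rw [e]
  field_simp
  ring

theorem pushLeft_right {x : ℝ} (h : x ∈ Set.Icc (1 : ℝ) 2) : pushLeft x = 1 / (3 - x) := by
  rw [pushLeft_apply, pushRight_left ⟨by linarith [h.2], by linarith [h.1]⟩]
  have : 3 - x ≠ 0 := by linarith [h.2]
  have e : 2 + (1 - x) = 3 - x := by ring
  rw [e]
  field_simp
  ring

theorem pushLeft_of_le {x : ℝ} (h : x ≤ 0) : pushLeft x = x := by
  rw [pushLeft_apply, pushRight_of_ge (by linarith)]; ring

theorem pushLeft_of_ge {x : ℝ} (h : 2 ≤ x) : pushLeft x = x - 1 := by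
  rw [pushLeft_apply, pushRight_of_le (by linarith)]; ring

theorem image_ratCast_subset_range {s : Set ℚ} : ((↑) '' s : Set ℝ) ⊆ Set.range ((↑) : ℚ → ℝ) :=
  Set.image_subset_range _ _

theorem isPW_pushRight : IsPW pushRight := by
  refine ⟨(↑) '' ({-1, 0, 1} : Set ℚ), Set.Finite.image _ (by simp), image_ratCast_subset_range, ?_⟩
  intro x hx
  simp only [Set.image_insert_eq, Set.image_singleton, Rat.cast_neg, Rat.cast_one, Rat.cast_zero,
    Set.mem_insert_iff, Set.mem_singleton_iff, not_or] at hx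
  obtain ⟨h1, h2, h3⟩ := hx
  rcases lt_or_gt_of_ne h1 with h1 | h1
  · refine ⟨slMk 1 1 0 1 (by norm_num), ?_⟩
    filter_upwards [Iio_mem_nhds h1] with y hy
    rw [mobRel_slMk, pushRight_of_le (le_of_lt hy)]
    push_cast; ring
  rcases lt_or_gt_of_ne h2 with h2 | h2
  · refine ⟨slMk 1 1 1 2 (by norm_num), ?_⟩
    filter_upwards [Ioo_mem_nhds h1 h2] with y hy
    rw [mobRel_slMk, pushRight_left ⟨hy.1.le, hy.2.le⟩]
    have : 2 + y ≠ 0 := by linarith [hy.1]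
    push_cast; field_simp; ring
  rcases lt_or_gt_of_ne h3 with h3 | h3
  · refine ⟨slMk 0 1 (-1) 2 (by norm_num), ?_⟩
    filter_upwards [Ioo_mem_nhds h2 h3] with y hy
    rw [mobRel_slMk, pushRight_right ⟨hy.1.le, hy.2.le⟩]
    have : 2 - y ≠ 0 := by linarith [hy.2]
    push_cast; field_simp; ring
  · refine ⟨1, ?_⟩
    filter_upwards [Ioi_mem_nhds h3] with y hy
    rw [pushRight_of_ge (le_of_lt hy)]
    exact MobRel.one y

theorem isPW_pushLeft : IsPW pushLeft := by
  refine ⟨(↑) '' ({0, 1, 2} : Set ℚ), Set.Finite.image _ (by simp), image_ratCast_subset_range, ?_⟩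
  intro x hx
  simp only [Set.image_insert_eq, Set.image_singleton, Rat.cast_ofNat, Rat.cast_one, Rat.cast_zero,
    Set.mem_insert_iff, Set.mem_singleton_iff, not_or] at hx
  obtain ⟨h1, h2, h3⟩ := hx
  rcases lt_or_gt_of_ne h1 with h1 | h1
  · refine ⟨1, ?_⟩
    filter_upwards [Iio_mem_nhds h1] with y hy
    rw [pushLeft_of_le (le_of_lt hy)]
    exact MobRel.one y
  rcases lt_or_gt_of_ne h2 with h2 | h2
  · refine ⟨slMk 1 0 1 1 (by norm_num), ?_⟩
    filter_upwards [Ioo_mem_nhds h1 h2] with y hy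
    rw [mobRel_slMk, pushLeft_left ⟨hy.1.le, hy.2.le⟩]
    have : 1 + y ≠ 0 := by linarith [hy.1]
    push_cast; field_simp; ring
  rcases lt_or_gt_of_ne h3 with h3 | h3
  · refine ⟨slMk 0 1 (-1) 3 (by norm_num), ?_⟩
    filter_upwards [Ioo_mem_nhds h2 h3] with y hy
    rw [mobRel_slMk, pushLeft_right ⟨hy.1.le, hy.2.le⟩]
    have : 3 - y ≠ 0 := by linarith [hy.2]
    push_cast; field_simp; ring
  · refine ⟨slMk 1 (-1) 0 1 (by norm_num), ?_⟩
    filter_upwards [Ioi_mem_nhds h3] with y hy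
    rw [mobRel_slMk, pushLeft_of_ge (le_of_lt hy)]
    push_cast; ring

/-- This and the following conjugates move doublings between the intervals needed for the
telescoping product in `S` and for the images of the bends. The four numbers given to
`mul_double_eq` are the coefficients of the relevant projective piece. -/
theorem pushRight_conj_zero_one :
    pushRight * double 0 1 * pushRight⁻¹ = double (1 / 2) 1 := by
  rw [mul_double_eq 0 1 (-1) 2 one_pos (by norm_num) (by norm_num) (by norm_num),
    pushRight_right (by norm_num), pushRight_right (by norm_num)]
  · norm_num
  · intro x hx
    rw [pushRight_right hx]
    congr 1 <;> ring

theorem pushRight_conj_zero_half :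
    pushRight * double 0 (1 / 2) * pushRight⁻¹ = double (1 / 2) (2 / 3) := by
  rw [mul_double_eq 0 1 (-1) 2 (by norm_num) (by norm_num) (by norm_num) (by norm_num),
    pushRight_right (by norm_num), pushRight_right (by norm_num)]
  · norm_num
  · intro x hx
    rw [pushRight_right ⟨hx.1, by linarith [hx.2]⟩]
    congr 1 <;> ring

theorem pushRight_conj_half_one :
    pushRight * double (1 / 2) 1 * pushRight⁻¹ = double (2 / 3) 1 := by
  rw [mul_double_eq 0 1 (-1) 2 (by norm_num) (by norm_num) (by norm_num) (by norm_num),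
    pushRight_right (by norm_num), pushRight_right (by norm_num)]
  · norm_num
  · intro x hx
    rw [pushRight_right ⟨by linarith [hx.1], hx.2⟩]
    congr 1 <;> ring

theorem pushRight_conj_one_two :
    pushRight * double 1 2 * pushRight⁻¹ = double 1 2 := by
  rw [mul_double_eq 1 0 0 1 (by norm_num) (by norm_num) (by norm_num) (by norm_num),
    pushRight_of_ge (by norm_num), pushRight_of_ge (by norm_num)]
  intro x hx
  rw [pushRight_of_ge hx.1]
  ring

theorem pushLeft_conj_zero_one :
    pushLeft * double 0 1 * pushLeft⁻¹ = double 0 (1 / 2) := by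
  rw [mul_double_eq 1 0 1 1 (by norm_num) (by norm_num) (by norm_num) (by norm_num),
    pushLeft_left (by norm_num), pushLeft_left (by norm_num)]
  · norm_num
  · intro x hx
    rw [pushLeft_left hx]
    congr 1 <;> ring

theorem pushLeft_conj_one_two :
    pushLeft * double 1 2 * pushLeft⁻¹ = double (1 / 2) 1 := by
  rw [mul_double_eq 0 1 (-1) 3 (by norm_num) (by norm_num) (by norm_num) (by norm_num),
    pushLeft_right (by norm_num), pushLeft_right (by norm_num)]
  · norm_num
  · intro x hx
    rw [pushLeft_right hx]
    congr 1 <;> ring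

/-! ### Localization of elements of `F` -/

theorem locMob_shrink {t : ℝ} (ht : t ≠ 0) : LocMob shrink t := by
  rcases lt_or_gt_of_ne ht with h | h
  · refine ⟨slMk 0 1 (-1) 2 (by norm_num), ?_⟩
    filter_upwards [Iio_mem_nhds h] with y hy
    rw [mobRel_slMk, shrink_of_nonpos (le_of_lt hy)]
    have : 2 - y ≠ 0 := by linarith [Set.mem_Iio.1 hy]
    push_cast; field_simp; ring
  · refine ⟨slMk 1 1 1 2 (by norm_num), ?_⟩
    filter_upwards [Ioi_mem_nhds h] with y hy
    rw [mobRel_slMk, shrink_of_nonneg (le_of_lt hy)]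
    have : 2 + y ≠ 0 := by linarith [Set.mem_Ioi.1 hy]
    push_cast; field_simp; ring

theorem locMob_stretch {x : ℝ} (h0 : 0 < x) (h1 : x < 1) (h : x ≠ 1 / 2) : LocMob stretch x := by
  rcases lt_or_gt_of_ne h with h | h
  · refine ⟨slMk 2 (-1) 1 0 (by norm_num), ?_⟩
    filter_upwards [Ioo_mem_nhds h0 h] with y hy
    rw [mobRel_slMk, stretch_of_le hy.2.le]
    have : y ≠ 0 := hy.1.ne'
    push_cast; field_simp; ring
  · refine ⟨slMk 2 (-1) (-1) 1 (by norm_num), ?_⟩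
    filter_upwards [Ioo_mem_nhds h h1] with y hy
    rw [mobRel_slMk, stretch_of_ge hy.1.le]
    have : 1 - y ≠ 0 := by linarith [hy.2]
    push_cast; field_simp; ring

theorem shrink_ratCast (q : ℚ) : shrink q ∈ Set.range ((↑) : ℚ → ℝ) := by
  rcases le_total (q : ℝ) 0 with h | h
  · exact ⟨1 / (2 - q), by rw [shrink_of_nonpos h]; push_cast; rfl⟩
  · exact ⟨(1 + q) / (2 + q), by rw [shrink_of_nonneg h]; push_cast; rfl⟩

/-- Since `shrink` breaks at `0`, the preimage of `0` may give a new breakpoint of `squeeze g`, so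
it must be rational. Away from the breakpoints of `g` it solves `a t + b = 0` with integers `a ≠ 0`
and `b`. -/
theorem IsPW.exists_preimage_zero {g : ℝ ≃o ℝ} (hg : IsPW g) :
    ∃ q : ℚ, g q = 0 := by
  obtain ⟨B, -, hr, hloc⟩ := hg
  obtain ⟨t, ht⟩ := g.surjective 0
  suffices h : t ∈ Set.range ((↑) : ℚ → ℝ) by
    obtain ⟨q, rfl⟩ := h
    exact ⟨q, ht⟩
  by_cases hB : t ∈ B
  · exact hr hB
  · obtain ⟨A, hA⟩ := hloc t hB
    have h := hA.self_of_nhds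
    have hd := det_eq_one_real A
    rw [ht, MobRel, zero_mul] at h
    have h0 : ((A 0 0 : ℤ) : ℝ) ≠ 0 := by
      intro h0
      rw [h0, zero_mul, zero_add] at h
      rw [h0, ← h] at hd
      simp at hd
    refine ⟨-(A 0 1 : ℤ) / (A 0 0 : ℤ), ?_⟩
    push_cast
    rw [div_eq_iff h0]
    linear_combination h

/-- Possible breakpoints: the ends `0` and `1`, the breakpoint `1/2` of `stretch`, and the images
under `shrink` of the breakpoints of `g` and of `g⁻¹(0)`. -/
theorem IsPW.squeeze {g : ℝ ≃o ℝ} (hg : IsPW g) : IsPW (squeeze g) := by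
  obtain ⟨q₀, hq₀⟩ := hg.exists_preimage_zero
  obtain ⟨B, hB, hr, hloc⟩ := hg
  refine ⟨{0, 1, 1 / 2} ∪ shrink '' insert (q₀ : ℝ) B, ?_, ?_, ?_⟩
  · exact (Set.toFinite _).union ((hB.insert _).image _)
  · apply Set.union_subset
    · rintro x (rfl | rfl | rfl)
      · exact ⟨0, by simp⟩
      · exact ⟨1, by simp⟩
      · exact ⟨1 / 2, by simp⟩
    · rintro _ ⟨x, rfl | hx, rfl⟩
      · exact shrink_ratCast q₀
      · obtain ⟨q, rfl⟩ := hr hx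
        exact shrink_ratCast q
  · intro x hx
    simp only [Set.mem_union, Set.mem_insert_iff, Set.mem_singleton_iff, not_or] at hx
    obtain ⟨⟨h0, h1, h2⟩, h3⟩ := hx
    have ident : ∀ s ∈ 𝓝 x, (∀ y ∈ s, ¬ (0 < y ∧ y < 1)) → LocMob (LodhaMoore.squeeze g) x := by
      intro s hs h
      refine ⟨1, ?_⟩
      filter_upwards [hs] with y hy
      rw [squeeze_of_notMem g (h y hy)]
      exact MobRel.one y
    rcases lt_or_gt_of_ne h0 with h0 | h0
    · exact ident _ (Iio_mem_nhds h0) fun y hy h => lt_asymm h.1 hy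
    rcases lt_or_gt_of_ne h1 with h1 | h1
    · have hs := shrink_stretch ⟨h0, h1⟩
      have hB' : stretch x ∉ insert (q₀ : ℝ) B := fun h => h3 ⟨_, h, hs⟩
      rw [Set.mem_insert_iff, not_or] at hB'
      have hne : g (stretch x) ≠ 0 := by
        rw [← hq₀]
        exact g.injective.ne hB'.1
      have h4 := LocMob.comp (f := fun y => g (stretch y)) (locMob_shrink hne)
        ((hloc _ hB'.2).comp (locMob_stretch h0 h1 h2))
      refine h4.congr ?_
      filter_upwards [Ioo_mem_nhds h0 h1] with y hy
      conv_lhs => rw [← shrink_stretch hy, squeeze_shrink]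
    · exact ident _ (Ioi_mem_nhds h1) fun y hy h => lt_asymm h.2 hy

/-! ### The embeddings -/

theorem toCirc_mem_S {g : ℝ ≃o ℝ} (h : IsPW g) : toCirc g ∈ S :=
  Subgroup.subset_closure (Or.inl (toCirc_mem_thompsonT_iff.2 h))

theorem toCirc_mem_G0 {g : ℝ ≃o ℝ} (h : IsPW g) : toCirc g ∈ G0 :=
  Subgroup.subset_closure (Or.inl (toCirc_mem_thompsonF h))

theorem conj_mem_comap {G : Subgroup (Circ ≃ₜ Circ)} {g h : ℝ ≃o ℝ} (hg : g ∈ G.comap toCirc)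
    (hh : h ∈ G.comap toCirc) : g * h * g⁻¹ ∈ G.comap toCirc :=
  mul_mem (mul_mem hg hh) (inv_mem hg)

/-- This is the corrected image of `c`. Conjugating `s` by `pushLeft` and then `pushRight` gives
`double (1/2) (2/3) * (double (2/3) 1)⁻¹`; conjugating it twice by `pushRight` gives `double (2/3) 1
* (double 1 2)⁻¹`. In the product the middle factors cancel. -/
theorem double_half_mul_mem_S : toCirc (double (1 / 2) (2 / 3) * (double 1 2)⁻¹) ∈ S := by
  have hr : pushRight ∈ S.comap toCirc := toCirc_mem_S isPW_pushRight
  have hl : pushLeft ∈ S.comap toCirc := toCirc_mem_S isPW_pushLeft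
  have hs : double 0 1 * (double 1 2)⁻¹ ∈ S.comap toCirc := by
    rw [Subgroup.mem_comap, toCirc_double_sMap]
    exact Subgroup.subset_closure (Or.inr rfl)
  have conj : ∀ g a b : ℝ ≃o ℝ, g * (a * b⁻¹) * g⁻¹ = (g * a * g⁻¹) * (g * b * g⁻¹)⁻¹ := by
    intro g a b; group
  have h1 := conj_mem_comap hr (conj_mem_comap hl hs)
  have h2 := conj_mem_comap hr (conj_mem_comap hr hs)
  rw [conj pushLeft, pushLeft_conj_zero_one, pushLeft_conj_one_two, conj,
    pushRight_conj_zero_half, pushRight_conj_half_one] at h1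
  rw [conj _ (double 0 1), pushRight_conj_zero_one, pushRight_conj_one_two, conj,
    pushRight_conj_half_one, pushRight_conj_one_two] at h2
  have h3 := mul_mem h1 h2
  rwa [mul_assoc, inv_mul_cancel_left] at h3

/-- Induction on generators, with `n = 0` on `F` and `n = 1` on `c`. Carrying the total jump along
makes `n` depend on `h` alone; commutation with `double 1 2` makes the membership in `S`
multiplicative. -/
theorem exists_of_mem_G0 {h : Circ ≃ₜ Circ} (hh : h ∈ G0) : ∃ (g : ℝ ≃o ℝ) (n : ℤ),
    toCirc g = h ∧ HasTotalJump (squeeze g) (n * (2 * Real.log 2)) ∧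
      toCirc (squeeze g * double 1 2 ^ (-n)) ∈ S := by
  have comm (g : ℝ ≃o ℝ) (n : ℤ) : Commute (squeeze g) (double 1 2 ^ n) :=
    (commute_squeeze_double g).zpow_right n
  refine Subgroup.closure_induction ?_ ?_ ?_ ?_ hh
  · rintro x (hx | rfl)
    · obtain ⟨g, rfl, hg⟩ := exists_toCirc_of_mem_thompsonF hx
      refine ⟨g, 0, rfl, ?_, ?_⟩
      · simpa using hg.squeeze.hasTotalJump
      · simpa using toCirc_mem_S hg.squeeze
    · refine ⟨double 0 1, 1, toCirc_double_zero_one, ?_, ?_⟩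
      · rw [squeeze_double, Int.cast_one, one_mul]
        exact hasTotalJump_double (by norm_num)
      · rw [squeeze_double, zpow_neg_one]
        exact double_half_mul_mem_S
  · refine ⟨1, 0, map_one _, ?_, ?_⟩
    · simpa using HasTotalJump.one
    · simp
  · rintro _ _ - - ⟨g, n, rfl, hg, hgS⟩ ⟨k, m, rfl, hk, hkS⟩
    refine ⟨g * k, n + m, map_mul _ _ _, ?_, ?_⟩
    · rw [map_mul, Int.cast_add, add_mul]
      exact hg.mul hk
    · have := mul_mem hgS hkS
      rw [← map_mul] at this
      convert this using 2
      rw [map_mul, neg_add, zpow_add]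
      exact (comm k (-n)).mul_mul_mul_comm _ _
  · rintro _ - ⟨g, n, rfl, hg, hgS⟩
    refine ⟨g⁻¹, -n, map_inv _ _, ?_, ?_⟩
    · rw [map_inv, Int.cast_neg, neg_mul]
      exact hg.inv
    · have := inv_mem hgS
      rw [← map_inv] at this
      convert this using 2
      rw [map_inv, mul_inv_rev, zpow_neg _ (-n)]
      exact ((comm g (-n)).inv_inv).eq

/-- The homeomorphism of the line underlying an element of `G₀`. -/
def lineMap (h : G0) : ℝ ≃o ℝ := (exists_of_mem_G0 h.2).choose

/-- The total exponent of an element of `G₀`. -/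
def exponent (h : G0) : ℤ := (exists_of_mem_G0 h.2).choose_spec.choose

theorem toCirc_lineMap (h : G0) : toCirc (lineMap h) = h :=
  (exists_of_mem_G0 h.2).choose_spec.choose_spec.1

theorem hasTotalJump_lineMap (h : G0) :
    HasTotalJump (squeeze (lineMap h)) (exponent h * (2 * Real.log 2)) :=
  (exists_of_mem_G0 h.2).choose_spec.choose_spec.2.1

theorem lineMap_mem_S (h : G0) :
    toCirc (squeeze (lineMap h) * double 1 2 ^ (-exponent h)) ∈ S :=
  (exists_of_mem_G0 h.2).choose_spec.choose_spec.2.2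

theorem lineMap_mul (h k : G0) : lineMap (h * k) = lineMap h * lineMap k :=
  toCirc_injective (by simp [toCirc_lineMap])

theorem exponent_unique {g : ℝ ≃o ℝ} {n m : ℤ} (hn : HasTotalJump g (n * (2 * Real.log 2)))
    (hm : HasTotalJump g (m * (2 * Real.log 2))) : n = m := by
  have h0 : (2 * Real.log 2) ≠ 0 := by
    have := Real.log_pos one_lt_two
    positivity
  exact_mod_cast mul_right_cancel₀ h0 (hn.unique hm)

theorem exponent_mul (h k : G0) : exponent (h * k) = exponent h + exponent k := by
  apply exponent_unique (hasTotalJump_lineMap (h * k))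
  rw [lineMap_mul, map_mul, Int.cast_add, add_mul]
  exact (hasTotalJump_lineMap h).mul (hasTotalJump_lineMap k)

/-- The embedding of `G₀` into `S`. -/
def embedding : G0 →* S :=
  MonoidHom.mk' (fun h => ⟨_, lineMap_mem_S h⟩) fun h k => by
    apply Subtype.ext
    change toCirc _ = toCirc _ * toCirc _
    rw [← map_mul, lineMap_mul, exponent_mul, map_mul squeeze, neg_add, zpow_add]
    congr 1
    exact ((commute_squeeze_double _).zpow_right _).mul_mul_mul_comm _ _

theorem coe_embedding (h : G0) : (embedding h : Circ ≃ₜ Circ) =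
    toCirc (squeeze (lineMap h) * double 1 2 ^ (-exponent h)) := rfl

theorem double_zpow_of_notMem {p q x : ℝ} (h : ¬ (p < x ∧ x < q)) (n : ℤ) :
    (double p q ^ n) x = x := by
  have h1 : double p q ∈ MulAction.stabilizer (ℝ ≃o ℝ) x := double_of_notMem h
  exact zpow_mem h1 n

/-- The correcting factor is the identity on `(0, 1)`, so `squeeze` of the underlying map can be
read off there. -/
theorem embedding_injective : Function.Injective embedding := by
  rw [injective_iff_map_eq_one]
  intro h hh
  have h1 : toCirc (squeeze (lineMap h) * double 1 2 ^ (-exponent h)) = 1 := by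
    rw [← coe_embedding, hh]; rfl
  rw [← map_one toCirc] at h1
  have h2 := toCirc_injective h1
  have h3 : squeeze (lineMap h) = squeeze 1 := by
    apply squeeze_eq
    · intro x _
      simp
    · intro t
      have h4 := DFunLike.congr_fun h2 (shrink t)
      have h5 : (double 1 2 ^ (-exponent h)) (shrink t) = shrink t :=
        double_zpow_of_notMem (fun h => lt_asymm h.1 (shrink_lt_one t)) _
      rw [RelIso.mul_apply, h5, squeeze_shrink] at h4
      rw [squeeze_shrink]
      exact h4.symm
  have h6 := squeeze_injective h3
  apply Subtype.ext
  rw [← toCirc_lineMap, h6, map_one]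
  rfl

/-- Increasing homeomorphisms of the line, as homeomorphisms. -/
def toLine : (ℝ ≃o ℝ) →* (ℝ ≃ₜ ℝ) where
  toFun g := g.toHomeomorph
  map_one' := rfl
  map_mul' _ _ := rfl

/-- After squeezing, the translation lies in `F`, the first bend is a conjugate of `c`, and the
second is the inverse of one. -/
theorem exists_of_mem_BB12 {h : ℝ ≃ₜ ℝ} (hh : h ∈ BB12) :
    ∃ g : ℝ ≃o ℝ, toLine g = h ∧ toCirc (squeeze g) ∈ G0 := by
  have hc : double 0 1 ∈ G0.comap toCirc := by
    rw [Subgroup.mem_comap, toCirc_double_zero_one]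
    exact Subgroup.subset_closure (Or.inr rfl)
  have hr : pushRight ∈ G0.comap toCirc := toCirc_mem_G0 isPW_pushRight
  have hl : pushLeft ∈ G0.comap toCirc := toCirc_mem_G0 isPW_pushLeft
  refine Subgroup.closure_induction ?_ ?_ ?_ ?_ hh
  · rintro x (rfl | rfl | rfl)
    · refine ⟨OrderIso.addRight 1, rfl, toCirc_mem_G0 (IsPW.squeeze ?_)⟩
      refine ⟨∅, Set.finite_empty, Set.empty_subset _, fun x _ => ?_⟩
      refine ⟨slMk 1 1 0 1 (by norm_num), Filter.Eventually.of_forall fun y => ?_⟩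
      rw [mobRel_slMk, OrderIso.addRight_apply]
      push_cast; ring
    · refine ⟨bend 1 2 one_pos two_pos, rfl, ?_⟩
      rw [squeeze_bend_one_two, ← pushRight_conj_zero_one]
      exact conj_mem_comap hr hc
    · refine ⟨bend 2 1 two_pos one_pos, rfl, ?_⟩
      rw [squeeze_bend_two_one, ← pushLeft_conj_zero_one]
      exact inv_mem (conj_mem_comap hl hc)
  · exact ⟨1, rfl, by simp⟩
  · rintro _ _ - - ⟨g, rfl, hg⟩ ⟨k, rfl, hk⟩
    exact ⟨g * k, rfl, by rw [map_mul, map_mul]; exact mul_mem hg hk⟩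
  · rintro _ - ⟨g, rfl, hg⟩
    exact ⟨g⁻¹, rfl, by rw [map_inv, map_inv]; exact inv_mem hg⟩

theorem exists_injective_BB12_G0 : ∃ j : BB12 →* G0, Function.Injective j := by
  choose g hg hgG using fun h : BB12 => exists_of_mem_BB12 h.2
  have inj : Function.Injective toLine := fun a b hab =>
    OrderIso.ext (congrArg (fun e : ℝ ≃ₜ ℝ => (e : ℝ → ℝ)) hab)
  have hmul : ∀ h k, g (h * k) = g h * g k := fun h k => inj (by simp [hg])
  refine ⟨MonoidHom.mk' (fun h => ⟨_, hgG h⟩) fun h k => ?_, fun h k hhk => ?_⟩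
  · apply Subtype.ext
    change toCirc _ = toCirc _ * toCirc _
    rw [hmul, map_mul, map_mul]
  · have h1 := squeeze_injective (toCirc_injective (congrArg Subtype.val hhk))
    apply Subtype.ext
    rw [← hg, ← hg]
    exact congrArg toLine h1

end

end LodhaMoore

/-! ### The coding of points by binary sequences. -/

namespace LodhaMoore

open Topology
open scoped ENNReal

noncomputable section

/-! ### Doubling in the continued fractions model -/

theorem half_coe (a : NNReal) : (1 + (a : ℝ≥0∞)⁻¹)⁻¹ = ((a / (1 + a) : NNReal) : ℝ≥0∞) := by
  rcases eq_or_ne a 0 with rfl | ha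
  · simp
  · rw [← ENNReal.coe_inv ha, ← ENNReal.coe_one, ← ENNReal.coe_add, ← ENNReal.coe_inv (by positivity)]
    congr 1
    field_simp
    ring

theorem half_le_one (a : ℝ≥0∞) : (1 + a⁻¹)⁻¹ ≤ 1 := by
  rw [ENNReal.inv_le_one]; exact le_self_add

theorem half_mono {a b : ℝ≥0∞} (h : a ≤ b) : (1 + a⁻¹)⁻¹ ≤ (1 + b⁻¹)⁻¹ := by
  rw [ENNReal.inv_le_inv]
  gcongr

/-- With `H(a) = a / (1 + a)` this reads `H(2a) = 2 H(H(a))`, the identity behind `y(00η) = 0 y(η)`.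
-/
theorem half_two_mul (a : NNReal) :
    (1 + (2 * (a : ℝ≥0∞))⁻¹)⁻¹ = 2 * (1 + ((1 + (a : ℝ≥0∞)⁻¹)⁻¹)⁻¹)⁻¹ := by
  have e : (2 * (a : ℝ≥0∞)) = ((2 * a : NNReal) : ℝ≥0∞) := by push_cast; rfl
  rw [e, half_coe, half_coe, half_coe, ← ENNReal.coe_ofNat, ← ENNReal.coe_mul]
  congr 1
  field_simp
  ring

/-- With the same `H`, the identity `1 + H(a) = 2 H(1 + 2a)` is the one behind `y⁻¹(10η) = 01 y(η)`
and `y(01η) = 10 y⁻¹(η)`. -/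
theorem one_add_half (a : NNReal) :
    1 + (1 + (a : ℝ≥0∞)⁻¹)⁻¹ = 2 * (1 + (1 + 2 * (a : ℝ≥0∞))⁻¹)⁻¹ := by
  have e : (1 + 2 * (a : ℝ≥0∞)) = ((1 + 2 * a : NNReal) : ℝ≥0∞) := by push_cast; rfl
  rw [e, half_coe, half_coe, ← ENNReal.coe_ofNat, ← ENNReal.coe_mul, ← ENNReal.coe_one,
    ← ENNReal.coe_add]
  congr 1
  field_simp
  ring

theorem phiApprox_ne_top (n : ℕ) (ξ : Cantor) : phiApprox n ξ ≠ ∞ := by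
  induction n generalizing ξ with
  | zero => simp [phiApprox]
  | succ n ih =>
    rw [phiApprox]
    split_ifs
    · exact ENNReal.add_ne_top.2 ⟨ENNReal.one_ne_top, ih _⟩
    · exact ne_top_of_le_ne_top ENNReal.one_ne_top (half_le_one _)

theorem phiApprox_succ_true (n : ℕ) (ξ : Cantor) :
    phiApprox (n + 1) (cons true ξ) = 1 + phiApprox n ξ := by simp [phiApprox]

theorem phiApprox_succ_false (n : ℕ) (ξ : Cantor) :
    phiApprox (n + 1) (cons false ξ) = (1 + (phiApprox n ξ)⁻¹)⁻¹ := by simp [phiApprox]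

theorem exists_eq_cons (ξ : Cantor) : ∃ b η, ξ = cons b η := ⟨_, _, (cons_tail ξ).symm⟩

/-- The recursions of `y` and `y⁻¹` call each other, so both lower bounds go through one induction.
The bound for `y⁻¹`, applied at `y ξ`, later becomes the upper bound for `y`. -/
theorem phiApprox_le_phi_yFun (n : ℕ) : ∀ ξ,
    2 * phiApprox n ξ ≤ phi (yFun true ξ) ∧ phiApprox n ξ ≤ 2 * phi (yFun false ξ) := by
  induction n with
  | zero => intro ξ; simp [phiApprox]
  | succ n ih =>
    intro ξ
    obtain ⟨b, η, rfl⟩ := exists_eq_cons ξ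
    obtain ⟨b', ζ, rfl⟩ := exists_eq_cons η
    -- When the recursion consumes two digits, passing to level `n + 2` leaves exactly level `n` on
    -- the remaining sequence, where the induction hypothesis applies.
    have step (ω : Cantor) : phiApprox (n + 1) ω ≤ phiApprox (n + 2) ω :=
      phiApprox_mono_succ (n + 1) ω
    obtain ⟨h1, h2⟩ := ih ζ
    obtain ⟨h3, h4⟩ := ih (cons b' ζ)
    lift phiApprox n ζ to NNReal using phiApprox_ne_top n ζ with a ha
    lift phiApprox n (cons b' ζ) to NNReal using phiApprox_ne_top n (cons b' ζ) with a' ha'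
    have two_half (c : NNReal) : (c : ℝ≥0∞) = 2 * ((c / 2 : NNReal) : ℝ≥0∞) := by
      rw [← ENNReal.coe_ofNat, ← ENNReal.coe_mul, mul_div_cancel₀ _ two_ne_zero]
    have cancel {c : NNReal} {d : ℝ≥0∞} (h : (c : ℝ≥0∞) ≤ 2 * d) :
        ((c / 2 : NNReal) : ℝ≥0∞) ≤ d := by
      rw [two_half] at h
      exact (ENNReal.mul_le_mul_iff_right two_ne_zero (by simp)).1 h
    constructor
    · rcases b with _ | _
      · refine (mul_le_mul_right (step _) 2).trans ?_
        rcases b' with _ | _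
        · rw [phiApprox_succ_false, phiApprox_succ_false, y_zero_zero, phi_zero, ← ha,
            ← half_two_mul]
          exact half_mono h1
        · rw [phiApprox_succ_false, phiApprox_succ_true, y_zero_one, phi_one, phi_zero, ← ha,
            two_half, ← one_add_half]
          gcongr
          exact cancel h2
      · rw [phiApprox_succ_true, y_one, phi_one, phi_one, ← ha', mul_add, mul_one, ← add_assoc,
          one_add_one_eq_two]
        gcongr
    · rcases b with _ | _
      · rw [phiApprox_succ_false, yInv_zero, phi_zero, phi_zero, ← ha', two_half, half_two_mul]
        gcongr
        exact cancel h4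
      · refine (step _).trans ?_
        rcases b' with _ | _
        · rw [phiApprox_succ_true, phiApprox_succ_false, yInv_one_zero, phi_zero, phi_one, ← ha,
            one_add_half]
          gcongr
        · rw [phiApprox_succ_true, phiApprox_succ_true, yInv_one_one, phi_one, ← ha, mul_add,
            mul_one, ← add_assoc, one_add_one_eq_two]
          gcongr

theorem phi_y (ξ : Cantor) : phi (y ξ) = 2 * phi ξ := by
  apply le_antisymm
  · refine iSup_le fun n => ?_
    have := (phiApprox_le_phi_yFun n (y ξ)).2
    have e : yFun false (y ξ) = ξ := y.symm_apply_apply ξ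
    rwa [e] at this
  · rw [phi, ENNReal.mul_iSup]
    exact iSup_le fun n => (phiApprox_le_phi_yFun n ξ).1

/-! ### The unit interval model -/

/-- The coordinate of `10ξ` in the continued fractions model. -/
def psi (ξ : Cantor) : ℝ := (phi (cons false ξ)).toReal

theorem psi_of_top {ξ : Cantor} (h : phi ξ = ∞) : psi ξ = 1 := by
  simp [psi, phi_zero, h]

theorem psi_of_coe {ξ : Cantor} {u : NNReal} (h : phi ξ = u) : psi ξ = u / (1 + u) := by
  rw [psi, phi_zero, h, half_coe, ENNReal.coe_toReal]
  push_cast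
  rfl

theorem psi_mem_Icc (ξ : Cantor) : psi ξ ∈ Set.Icc (0 : ℝ) 1 := by
  refine ⟨ENNReal.toReal_nonneg, ?_⟩
  rw [psi, phi_zero]
  exact ENNReal.toReal_le_of_le_ofReal zero_le_one (by simp)

theorem psi_zero (ξ : Cantor) : psi (cons false ξ) = psi ξ / (1 + psi ξ) := by
  have h : phi (cons false ξ) ≠ ∞ := by
    rw [phi_zero]; exact ne_top_of_le_ne_top ENNReal.one_ne_top (half_le_one _)
  lift phi (cons false ξ) to NNReal using h with u hu
  rw [psi_of_coe hu.symm, psi, ← hu]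
  simp

theorem psi_one (ξ : Cantor) : psi (cons true ξ) = 1 / (2 - psi ξ) := by
  rcases eq_or_ne (phi ξ) ∞ with h | h
  · rw [psi_of_top h, psi_of_top (by rw [phi_one, h]; rfl)]; norm_num
  · lift phi ξ to NNReal using h with u hu
    have h1 : phi (cons true ξ) = ((1 + u : NNReal) : ℝ≥0∞) := by rw [phi_one, ← hu]; simp
    rw [psi_of_coe hu.symm, psi_of_coe h1]
    have e : 2 - (u : ℝ) / (1 + u) = (2 + u) / (1 + u) := by field_simp; ring
    rw [e]
    push_cast
    rw [one_div_div]
    congr 1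
    ring

/-- The coordinate `psi / (1 - psi)` is `phi`, which `y` doubles; the value `phi = ∞` corresponds to
the fixed endpoint `1`. -/
theorem psi_y (ξ : Cantor) : psi (y ξ) = double 0 1 (psi ξ) := by
  have hm := psi_mem_Icc ξ
  rw [double_of_mem_Icc one_pos hm]
  rcases eq_or_ne (phi ξ) ∞ with h | h
  · rw [psi_of_top h, psi_of_top (by rw [phi_y, h]; simp)]; norm_num
  · lift phi ξ to NNReal using h with u hu
    have h1 : phi (y ξ) = ((2 * u : NNReal) : ℝ≥0∞) := by rw [phi_y, ← hu]; simp
    rw [psi_of_coe hu.symm, psi_of_coe h1]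
    have e : 1 - (u : ℝ) / (1 + u) + 2 * (u / (1 + u) - 0) = (1 + 2 * u) / (1 + u) := by
      field_simp; ring
    rw [e]
    push_cast
    field_simp
    ring

/-- The matrix of the map of the unit interval given by a digit. -/
def digitMat (b : Bool) : Matrix.SpecialLinearGroup (Fin 2) ℤ :=
  if b then slMk 0 1 (-1) 2 (by norm_num) else slMk 1 0 1 1 (by norm_num)

/-- The matrix of the map of the unit interval given by a finite sequence. -/
def wordMat : List Bool → Matrix.SpecialLinearGroup (Fin 2) ℤ
  | [] => 1
  | b :: s => digitMat b * wordMat s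

/-- A function with the same recursion as `psi`. -/
def IsCoord (χ : Cantor → ℝ) : Prop :=
  (∀ ξ, χ ξ ∈ Set.Icc (0 : ℝ) 1) ∧ (∀ ξ, χ (cons false ξ) = χ ξ / (1 + χ ξ)) ∧
    ∀ ξ, χ (cons true ξ) = 1 / (2 - χ ξ)

theorem isCoord_psi : IsCoord psi := ⟨psi_mem_Icc, psi_zero, psi_one⟩

theorem mobRel_digitMat_false {x : ℝ} (h : x ∈ Set.Icc (0 : ℝ) 1) :
    MobRel (digitMat false) x (x / (1 + x)) := by
  have : 1 + x ≠ 0 := by linarith [h.1]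
  rw [digitMat, if_neg (by simp), mobRel_slMk]
  push_cast; field_simp; ring

theorem mobRel_digitMat_true {x : ℝ} (h : x ∈ Set.Icc (0 : ℝ) 1) :
    MobRel (digitMat true) x (1 / (2 - x)) := by
  have : 2 - x ≠ 0 := by linarith [h.2]
  rw [digitMat, if_pos rfl, mobRel_slMk]
  push_cast; field_simp; ring

theorem IsCoord.mobRel {χ : Cantor → ℝ} (hχ : IsCoord χ) (s : List Bool) (ξ : Cantor) :
    MobRel (wordMat s) (χ ξ) (χ (prepend s ξ)) := by
  induction s with
  | nil => exact MobRel.one _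
  | cons b s ih =>
    refine MobRel.mul ?_ ih
    change MobRel _ _ (χ (cons b (prepend s ξ)))
    cases b
    · rw [hχ.2.1]; exact mobRel_digitMat_false (hχ.1 _)
    · rw [hχ.2.2]; exact mobRel_digitMat_true (hχ.1 _)

/-- The entries of the matrix of a finite sequence. -/
theorem wordMat_entries (s : List Bool) :
    0 ≤ wordMat s 0 1 ∧ wordMat s 0 1 ≤ wordMat s 1 1 ∧ 0 ≤ wordMat s 0 0 + wordMat s 0 1 ∧
      wordMat s 0 0 + wordMat s 0 1 ≤ wordMat s 1 0 + wordMat s 1 1 ∧ 0 < wordMat s 1 1 ∧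
      0 < wordMat s 1 0 + wordMat s 1 1 ∧
      s.length + 2 ≤ wordMat s 1 1 + (wordMat s 1 0 + wordMat s 1 1) := by
  induction s with
  | nil => simp [wordMat]
  | cons b s ih =>
    have e : ∀ i j, wordMat (b :: s) i j =
        digitMat b i 0 * wordMat s 0 j + digitMat b i 1 * wordMat s 1 j := by
      intro i j
      exact (Matrix.mul_apply (M := (digitMat b).1) (N := (wordMat s).1)).trans
        (Fin.sum_univ_two _)
    have hd := det_eq_one (wordMat s)
    obtain ⟨h1, h2, h3, h4, h5, h6, h7⟩ := ih
    simp only [e, List.length_cons]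
    generalize wordMat s 0 0 = a at *
    generalize wordMat s 0 1 = b' at *
    generalize wordMat s 1 0 = c at *
    generalize wordMat s 1 1 = d at *
    clear e
    push_cast
    cases b
    · have e00 : digitMat false 0 0 = 1 := rfl
      have e01 : digitMat false 0 1 = 0 := rfl
      have e10 : digitMat false 1 0 = 1 := rfl
      have e11 : digitMat false 1 1 = 1 := rfl
      rw [e00, e01, e10, e11]
      -- The sum of the two denominators grows by the sum of the endpoint numerators. Were that
      -- zero, the determinant would vanish.
      have : 0 < b' + (a + b') := by
        by_contra hc
        obtain rfl : b' = 0 := by omega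
        obtain rfl : a = 0 := by omega
        simp at hd
      refine ⟨?_, ?_, ?_, ?_, ?_, ?_, ?_⟩ <;> linarith
    · have e00 : digitMat true 0 0 = 0 := rfl
      have e01 : digitMat true 0 1 = 1 := rfl
      have e10 : digitMat true 1 0 = -1 := rfl
      have e11 : digitMat true 1 1 = 2 := rfl
      rw [e00, e01, e10, e11]
      -- Here the growth is the sum of the differences between denominator and numerator; if it were
      -- zero, both rows would be equal.
      have : 0 < (d - b') + (c + d - (a + b')) := by
        by_contra hc
        obtain rfl : b' = d := by omega
        obtain rfl : a = c := by omega
        linarith [mul_comm a b']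
      refine ⟨?_, ?_, ?_, ?_, ?_, ?_, ?_⟩ <;> linarith

theorem wordMat_denom_pos (s : List Bool) {x : ℝ} (hx : x ∈ Set.Icc (0 : ℝ) 1) :
    0 < ((wordMat s 1 0 : ℤ) : ℝ) * x + (wordMat s 1 1 : ℤ) := by
  obtain ⟨-, -, -, -, h5, h6, -⟩ := wordMat_entries s
  have h5' : (0 : ℝ) < (wordMat s 1 1 : ℤ) := by exact_mod_cast h5
  have h6' : (0 : ℝ) < (wordMat s 1 0 : ℤ) + (wordMat s 1 1 : ℤ) := by exact_mod_cast h6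
  rcases hx.1.eq_or_lt with rfl | h0
  · simpa using h5'
  · nlinarith [mul_pos h0 h6', mul_nonneg (sub_nonneg.2 hx.2) h5'.le]

/-- The left endpoint of the interval of a finite sequence. -/
def lo (s : List Bool) : ℝ := (wordMat s 0 1 : ℤ) / (wordMat s 1 1 : ℤ)

/-- The right endpoint of the interval of a finite sequence. -/
def hi (s : List Bool) : ℝ :=
  ((wordMat s 0 0 : ℤ) + (wordMat s 0 1 : ℤ)) / ((wordMat s 1 0 : ℤ) + (wordMat s 1 1 : ℤ))

theorem mobRel_lo (s : List Bool) : MobRel (wordMat s) 0 (lo s) := by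
  have := wordMat_denom_pos s (x := 0) (by simp)
  rw [mul_zero, zero_add] at this
  rw [MobRel, lo]
  field_simp
  ring

theorem mobRel_hi (s : List Bool) : MobRel (wordMat s) 1 (hi s) := by
  have := wordMat_denom_pos s (x := 1) (by simp)
  rw [mul_one] at this
  rw [MobRel, hi, mul_one, mul_one]
  field_simp

theorem lo_nil : lo [] = 0 := by simp [lo, wordMat]

theorem hi_nil : hi [] = 1 := by simp [hi, wordMat]

theorem lo_mem_Icc (s : List Bool) : lo s ∈ Set.Icc (0 : ℝ) 1 := by
  obtain ⟨h1, h2, -, -, h5, -, -⟩ := wordMat_entries s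
  have h5' : (0 : ℝ) < (wordMat s 1 1 : ℤ) := by exact_mod_cast h5
  rw [lo, Set.mem_Icc, div_le_one h5']
  exact ⟨div_nonneg (by exact_mod_cast h1) h5'.le, by exact_mod_cast h2⟩

theorem hi_mem_Icc (s : List Bool) : hi s ∈ Set.Icc (0 : ℝ) 1 := by
  obtain ⟨-, -, h3, h4, -, h6, -⟩ := wordMat_entries s
  have h6' : (0 : ℝ) < (wordMat s 1 0 : ℤ) + (wordMat s 1 1 : ℤ) := by exact_mod_cast h6
  rw [hi, Set.mem_Icc, div_le_one h6']
  exact ⟨div_nonneg (by exact_mod_cast h3) h6'.le, by exact_mod_cast h4⟩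

theorem lo_cons_false (s : List Bool) : lo (false :: s) = lo s / (1 + lo s) :=
  (mobRel_lo (false :: s)).eq_div.trans
    ((mobRel_digitMat_false (lo_mem_Icc s)).mul (mobRel_lo s)).eq_div.symm

theorem hi_cons_false (s : List Bool) : hi (false :: s) = hi s / (1 + hi s) :=
  (mobRel_hi (false :: s)).eq_div.trans
    ((mobRel_digitMat_false (hi_mem_Icc s)).mul (mobRel_hi s)).eq_div.symm

theorem lo_cons_true (s : List Bool) : lo (true :: s) = 1 / (2 - lo s) :=
  (mobRel_lo (true :: s)).eq_div.trans
    ((mobRel_digitMat_true (lo_mem_Icc s)).mul (mobRel_lo s)).eq_div.symm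

theorem hi_cons_true (s : List Bool) : hi (true :: s) = 1 / (2 - hi s) :=
  (mobRel_hi (true :: s)).eq_div.trans
    ((mobRel_digitMat_true (hi_mem_Icc s)).mul (mobRel_hi s)).eq_div.symm

/-- The distance is `x / (d (c x + d)) ≤ 1 / (d (c + d))`. The denominators `d` and `c + d` are
positive integers with sum at least `length + 2`, so their product is at least `length + 1`. -/
theorem sub_lo_mem {s : List Bool} {x z : ℝ} (hx : x ∈ Set.Icc (0 : ℝ) 1)
    (h : MobRel (wordMat s) x z) : 0 ≤ z - lo s ∧ z - lo s ≤ 1 / (s.length + 1) := by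
  obtain ⟨-, -, -, -, h5, h6, h7⟩ := wordMat_entries s
  have hd := det_eq_one_real (wordMat s)
  have hden := wordMat_denom_pos s hx
  have h5' : (0 : ℝ) < (wordMat s 1 1 : ℤ) := by exact_mod_cast h5
  have h6' : (0 : ℝ) < (wordMat s 1 0 : ℤ) + (wordMat s 1 1 : ℤ) := by exact_mod_cast h6
  have h8 : (s.length : ℝ) + 1 ≤
      (wordMat s 1 1 : ℤ) * ((wordMat s 1 0 : ℤ) + (wordMat s 1 1 : ℤ)) := by
    have : (s.length : ℤ) + 1 ≤ wordMat s 1 1 * (wordMat s 1 0 + wordMat s 1 1) := by nlinarith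
    exact_mod_cast this
  have e : z - lo s = x / ((wordMat s 1 1 : ℤ) * ((wordMat s 1 0 : ℤ) * x + (wordMat s 1 1 : ℤ))) := by
    rw [h.eq_div, lo, div_sub_div _ _ hden.ne' h5'.ne', div_eq_div_iff (by positivity) (by positivity)]
    linear_combination x * (((wordMat s 1 0 : ℤ) * x + (wordMat s 1 1 : ℤ)) *
      ((wordMat s 1 1 : ℤ) : ℝ)) * hd
  rw [e]
  have hx0 := hx.1
  refine ⟨by positivity, ?_⟩
  rw [div_le_div_iff₀ (by positivity) (by positivity)]
  have := mul_le_mul_of_nonneg_left h8 hx0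
  nlinarith [mul_nonneg (mul_nonneg (sub_nonneg.2 hx.2) h5'.le) h5'.le]

theorem exists_prepend (n : ℕ) (ξ : Cantor) : ∃ s η, s.length = n ∧ ξ = prepend s η := by
  induction n generalizing ξ with
  | zero => exact ⟨[], ξ, rfl, rfl⟩
  | succ n ih =>
    obtain ⟨s, η, hs, h⟩ := ih (tail ξ)
    refine ⟨ξ 0 :: s, η, by rw [List.length_cons, hs], ?_⟩
    change ξ = cons (ξ 0) (prepend s η)
    rw [← h, cons_tail]

/-- Both values lie in the interval of the first `n` digits, of length at most `1 / (n + 1)`. This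
replaces a contraction argument: the digit maps have slope one at their fixed points `0` and `1`. -/
theorem IsCoord.eq_psi {χ : Cantor → ℝ} (hχ : IsCoord χ) (ξ : Cantor) : χ ξ = psi ξ := by
  rw [← sub_eq_zero, ← abs_nonpos_iff]
  refine ge_of_tendsto' tendsto_one_div_add_atTop_nhds_zero_nat fun n => ?_
  obtain ⟨s, η, rfl, rfl⟩ := exists_prepend n ξ
  have h1 := sub_lo_mem (hχ.1 η) (hχ.mobRel s η)
  have h2 := sub_lo_mem (psi_mem_Icc η) (isCoord_psi.mobRel s η)
  rw [abs_le]
  constructor <;> linarith [h1.1, h1.2, h2.1, h2.2]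

/-- The reflection `x ↦ 1 - x` exchanges the two digit maps, so uniqueness of the solution of the
recursion applies. -/
theorem psi_not (ξ : Cantor) : psi (fun n => !ξ n) = 1 - psi ξ := by
  have h : IsCoord fun ξ => 1 - psi (fun n => !ξ n) := by
    have e : ∀ b ξ, (fun n => !(cons b ξ n)) = cons (!b) fun n => !ξ n := by
      intro b ξ; funext n; cases n <;> rfl
    refine ⟨fun ξ => ?_, fun ξ => ?_, fun ξ => ?_⟩
    · have := psi_mem_Icc fun n => !ξ n
      exact ⟨by linarith [this.2], by linarith [this.1]⟩
    · have := psi_mem_Icc fun n => !ξ n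
      change 1 - psi (fun n => !(cons false ξ n)) = _
      rw [e, Bool.not_false, psi_one]
      have h1 : 2 - psi (fun n => !ξ n) ≠ 0 := by linarith [this.2]
      beta_reduce
      have h2 : 1 + (1 - psi (fun n => !ξ n)) = 2 - psi (fun n => !ξ n) := by ring
      rw [h2]
      field_simp
      ring
    · have := psi_mem_Icc fun n => !ξ n
      change 1 - psi (fun n => !(cons true ξ n)) = _
      rw [e, Bool.not_true, psi_zero]
      have h1 : 1 + psi (fun n => !ξ n) ≠ 0 := by linarith [this.1]
      beta_reduce
      have h2 : 2 - (1 - psi (fun n => !ξ n)) = 1 + psi (fun n => !ξ n) := by ring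
      rw [h2]
      field_simp
      ring
  linarith [h.eq_psi ξ]

theorem Phi_one_zero (ξ : Cantor) : Phi (cons true (cons false ξ)) = (psi ξ : ℝ) := by
  have h : phi (cons false ξ) ≠ ∞ := by
    rw [phi_zero]; exact ne_top_of_le_ne_top ENNReal.one_ne_top (half_le_one _)
  rw [Phi, cons_zero, if_pos rfl, tail_cons, if_neg h, psi]

/-- This is the origin of the formula for `shrink`: it expresses, on the line, the insertion of the
prefix `10`. -/
theorem psi_eq_shrink {ξ : Cantor} {t : ℝ} (h : Phi ξ = t) : psi ξ = shrink t := by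
  obtain ⟨b, η, rfl⟩ := exists_eq_cons ξ
  cases b
  · rw [Phi, cons_zero, if_neg (by simp), tail_cons] at h
    split_ifs at h with h1
    · exact absurd h (OnePoint.infty_ne_coe _)
    lift phi (fun n => !η n) to NNReal using h1 with u hu
    rw [OnePoint.coe_eq_coe, ENNReal.coe_toReal] at h
    have h2 := psi_of_coe hu.symm
    rw [psi_not] at h2
    have h3 : psi η = 1 / (1 + u) := by
      have : 1 - (u : ℝ) / (1 + u) = 1 / (1 + u) := by field_simp; ring
      linarith
    rw [psi_zero, h3, ← h, shrink_of_nonpos (by simp), sub_neg_eq_add]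
    field_simp
    ring
  · rw [Phi, cons_zero, if_pos rfl, tail_cons] at h
    split_ifs at h with h1
    · exact absurd h (OnePoint.infty_ne_coe _)
    lift phi η to NNReal using h1 with u hu
    rw [OnePoint.coe_eq_coe, ENNReal.coe_toReal] at h
    have h2 : phi (cons true η) = ((1 + u : NNReal) : ℝ≥0∞) := by rw [phi_one, ← hu]; simp
    rw [psi_of_coe h2, ← h, shrink_of_nonneg (by simp)]
    push_cast
    congr 1
    ring

/-- A digit `0` bounds the value by `1`, and a digit `1` passes infinity on to the tail. -/
theorem eq_const_of_phi_eq_top {ξ : Cantor} (h : phi ξ = ∞) : ξ = fun _ => true := by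
  funext n
  induction n generalizing ξ with
  | zero =>
    obtain ⟨b, η, rfl⟩ := exists_eq_cons ξ
    cases b
    · rw [phi_zero] at h
      exact absurd h (ne_top_of_le_ne_top ENNReal.one_ne_top (half_le_one _))
    · rfl
  | succ n ih =>
    obtain ⟨b, η, rfl⟩ := exists_eq_cons ξ
    cases b
    · rw [phi_zero] at h
      exact absurd h (ne_top_of_le_ne_top ENNReal.one_ne_top (half_le_one _))
    · rw [phi_one] at h
      exact ih (by simpa using h)

theorem cons_const (b : Bool) : cons b (fun _ => b) = fun _ => b := by
  funext n; cases n <;> rfl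

theorem eq_const_of_Phi_eq_infty {ξ : Cantor} (h : Phi ξ = OnePoint.infty) :
    ∃ b, ξ = fun _ => b := by
  obtain ⟨b, η, rfl⟩ := exists_eq_cons ξ
  refine ⟨b, ?_⟩
  cases b
  · rw [Phi, cons_zero, if_neg (by simp), tail_cons] at h
    split_ifs at h with h1
    · have h2 := eq_const_of_phi_eq_top h1
      have : η = fun _ => false := by
        funext n
        simpa using congrFun h2 n
      rw [this, cons_const]
    · exact absurd h (OnePoint.coe_ne_infty _)
  · rw [Phi, cons_zero, if_pos rfl, tail_cons] at h
    split_ifs at h with h1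
    · rw [eq_const_of_phi_eq_top h1, cons_const]
    · exact absurd h (OnePoint.coe_ne_infty _)

theorem psi_const (b : Bool) : psi (fun _ => b) = if b then 1 else 0 := by
  cases b
  · have h := psi_zero fun _ => false
    have h0 := (psi_mem_Icc fun _ => false).1
    rw [cons_const, eq_div_iff (by linarith)] at h
    have : psi (fun _ => false) ^ 2 = 0 := by linear_combination h
    simpa using this
  · have h := psi_one fun _ => true
    have h0 := (psi_mem_Icc fun _ => true).2
    rw [cons_const, eq_div_iff (by linarith)] at h
    have : (psi (fun _ => true) - 1) ^ 2 = 0 := by linear_combination -h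
    simpa [sub_eq_zero] using this

/-- Every rational number in `[0, 1)` is a value of `psi`. -/
theorem exists_psi_eq (N : ℕ) : ∀ m n : ℕ, m + n ≤ N → 0 < n →
    ∃ ξ, psi ξ = (m : ℝ) / (m + n) := by
  induction N with
  | zero => intro m n h hn; omega
  | succ N ih =>
    intro m n h hn
    have hn' : (0 : ℝ) < n := by exact_mod_cast hn
    rcases Nat.eq_zero_or_pos m with rfl | hm
    · exact ⟨fun _ => false, by simp [psi_const]⟩
    have hm' : (0 : ℝ) < m := by exact_mod_cast hm
    -- The subtractive Euclidean algorithm on `phi = m / n`: a digit `1` comes from `(m - n) / n`, a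
    -- digit `0` from `m / (n - m)`.
    rcases le_or_gt n m with hmn | hmn
    · obtain ⟨ξ, hξ⟩ := ih (m - n) n (by omega) hn
      refine ⟨cons true ξ, ?_⟩
      rw [Nat.cast_sub hmn, sub_add_cancel] at hξ
      rw [psi_one, hξ]
      have : (m : ℝ) + n ≠ 0 := by positivity
      have e : 2 - ((m : ℝ) - n) / m = (m + n) / m := by field_simp; ring
      rw [e, one_div_div]
    · obtain ⟨ξ, hξ⟩ := ih m (n - m) (by omega) (by omega)
      refine ⟨cons false ξ, ?_⟩
      rw [Nat.cast_sub hmn.le, add_sub_cancel] at hξ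
      rw [psi_zero, hξ]
      field_simp
      ring

theorem exists_psi_eq_ratCast {q : ℚ} (h : (q : ℝ) ∈ Set.Ioo (0 : ℝ) 1) : ∃ ξ, psi ξ = q := by
  have h0 : 0 < q.num := Rat.num_pos.2 (by exact_mod_cast h.1)
  have h1 : q.num < q.den := by
    have := h.2
    rw [Rat.cast_def, div_lt_one (by exact_mod_cast q.den_pos)] at this
    exact_mod_cast this
  obtain ⟨m, hm⟩ := Int.eq_ofNat_of_zero_le h0.le
  obtain ⟨ξ, hξ⟩ := exists_psi_eq _ m (q.den - m) le_rfl (by omega)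
  refine ⟨ξ, ?_⟩
  rw [hξ, Nat.cast_sub (by omega), add_sub_cancel, Rat.cast_def, hm]
  rfl

end

end LodhaMoore

/-! ### Words in the percolating elements and the maps they represent. -/

namespace LodhaMoore

open Topology
open scoped ENNReal

noncomputable section

/-! ### Words acting on the unit interval -/

/-- `psi` is a semiconjugacy from `w` to `g`. -/
def RepPsi (w : Equiv.Perm Cantor) (g : ℝ ≃o ℝ) : Prop := ∀ ξ, psi (w ξ) = g (psi ξ)

theorem RepPsi.mul {w v : Equiv.Perm Cantor} {g k : ℝ ≃o ℝ} (hw : RepPsi w g) (hv : RepPsi v k) :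
    RepPsi (w * v) (g * k) := fun ξ => by
  rw [Equiv.Perm.mul_apply, hw, hv]; rfl

theorem RepPsi.inv {w : Equiv.Perm Cantor} {g : ℝ ≃o ℝ} (hw : RepPsi w g) :
    RepPsi w⁻¹ g⁻¹ := fun ξ => by
  have h : psi ξ = g (psi (w⁻¹ ξ)) := by
    rw [← hw]; exact congrArg _ (w.apply_symm_apply ξ).symm
  rw [h]
  exact (g.symm_apply_apply _).symm

/-- A property of pairs closed under the group operations is closed under powers. -/
theorem zpow_pair {G H : Type*} [Group G] [Group H] {R : G → H → Prop} (one : R 1 1)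
    (mul : ∀ {a b c d}, R a b → R c d → R (a * c) (b * d)) (inv : ∀ {a b}, R a b → R a⁻¹ b⁻¹)
    {a : G} {b : H} (h : R a b) (n : ℤ) : R (a ^ n) (b ^ n) := by
  have hnat : ∀ m : ℕ, R (a ^ m) (b ^ m) := by
    intro m
    induction m with
    | zero => simpa using one
    | succ m ih => rw [pow_succ, pow_succ]; exact mul ih h
  cases n with
  | ofNat m => simpa using hnat m
  | negSucc m => rw [zpow_negSucc, zpow_negSucc]; exact inv (hnat _)

theorem RepPsi.zpow {w : Equiv.Perm Cantor} {g : ℝ ≃o ℝ} (hw : RepPsi w g) (n : ℤ) :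
    RepPsi (w ^ n) (g ^ n) :=
  zpow_pair (R := RepPsi) (fun _ => rfl) RepPsi.mul RepPsi.inv hw n

theorem HasTotalJump.zpow {g : ℝ ≃o ℝ} {s : ℝ} (hs : HasTotalJump g s) (n : ℤ) :
    HasTotalJump (g ^ n) (n * s) := by
  have := zpow_pair (R := fun (g : ℝ ≃o ℝ) (s : Multiplicative ℝ) => HasTotalJump g s.toAdd)
    HasTotalJump.one HasTotalJump.mul HasTotalJump.inv (b := Multiplicative.ofAdd s) hs n
  simpa using this

/-- Strict inequalities are needed, as an endpoint may be coded from the adjacent interval too. -/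
theorem exists_eq_prepend (s : List Bool) (ξ : Cantor) (h0 : lo s < psi ξ) (h1 : psi ξ < hi s) :
    ∃ η, ξ = prepend s η := by
  induction s generalizing ξ with
  | nil => exact ⟨ξ, rfl⟩
  | cons b s ih =>
    obtain ⟨b', η, rfl⟩ := exists_eq_cons ξ
    have hη := psi_mem_Icc η
    have hl := lo_mem_Icc s
    have hh := hi_mem_Icc s
    suffices h : b' = b ∧ lo s < psi η ∧ psi η < hi s by
      obtain ⟨rfl, h2, h3⟩ := h
      obtain ⟨ζ, rfl⟩ := ih η h2 h3
      exact ⟨ζ, rfl⟩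
    cases b
    · rw [lo_cons_false] at h0
      rw [hi_cons_false] at h1
      cases b'
      · rw [psi_zero, div_lt_div_iff₀ (by linarith [hl.1]) (by linarith [hη.1])] at h0
        rw [psi_zero, div_lt_div_iff₀ (by linarith [hη.1]) (by linarith [hh.1])] at h1
        exact ⟨rfl, by linarith, by linarith⟩
      · rw [psi_one, div_lt_div_iff₀ (by linarith [hη.2]) (by linarith [hh.1])] at h1
        nlinarith [mul_nonneg hh.1 hη.1, hh.2]
    · rw [lo_cons_true] at h0
      rw [hi_cons_true] at h1
      cases b'
      · rw [psi_zero, div_lt_div_iff₀ (by linarith [hl.2]) (by linarith [hη.1])] at h0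
        nlinarith [mul_nonneg hl.1 hη.1, hη.2]
      · rw [psi_one, div_lt_div_iff₀ (by linarith [hl.2]) (by linarith [hη.2])] at h0
        rw [psi_one, div_lt_div_iff₀ (by linarith [hη.2]) (by linarith [hh.2])] at h1
        exact ⟨rfl, by linarith, by linarith⟩

theorem lo_lt_hi (s : List Bool) : lo s < hi s := by
  have h := wordMat_denom_pos s (x := 0) (by simp)
  have h' := wordMat_denom_pos s (x := 1) (by simp)
  rw [mul_zero, zero_add] at h
  rw [mul_one] at h'
  rw [lo, hi, div_lt_div_iff₀ h h']
  linarith [det_eq_one_real (wordMat s)]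

/-- Prepending `s` acts through the projective map `wordMat s` from `[0, 1]` onto `[lo s, hi s]`, so
this is `psi_y` transported by naturality of doubling. -/
theorem repPsi_yAt (s : List Bool) : RepPsi (yAt s) (double (lo s) (hi s)) := by
  intro ξ
  by_cases h : ∃ η, ξ = prepend s η
  · obtain ⟨η, rfl⟩ := h
    have hd := det_eq_one_real (wordMat s)
    have h0 := wordMat_denom_pos s (x := 0) (by simp)
    have h1 := wordMat_denom_pos s (x := 1) (by simp)
    rw [yAt, loc_prepend, (isCoord_psi.mobRel s (y η)).eq_div, psi_y,
      (isCoord_psi.mobRel s η).eq_div, ← double_projective one_pos (by rw [hd]; exact one_pos) h0 h1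
      (psi_mem_Icc η), (mobRel_lo s).eq_div, (mobRel_hi s).eq_div]
  · rw [double_of_notMem fun h' => h (exists_eq_prepend s ξ h'.1 h'.2), yAt,
      loc_of_not_extends s y ξ fun η hη => h ⟨η, hη⟩]

/-! ### Tree diagram maps -/

theorem exists_leaf_mem (T : BinTree) {x : ℝ} (hx : x ∈ Set.Icc (0 : ℝ) 1) :
    ∃ u ∈ T.leaves, x ∈ Set.Icc (lo u) (hi u) := by
  induction T generalizing x with
  | leaf => exact ⟨[], by simp [BinTree.leaves], by rwa [lo_nil, hi_nil]⟩
  | node l r ihl ihr =>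
    obtain ⟨h0, h1⟩ := hx
    rcases le_total x (1 / 2) with h | h
    · have h2 : 0 < 1 - x := by linarith
      -- The argument is the preimage of `x` under the digit map `x / (1 + x)`; in the other half,
      -- `(2 * x - 1) / x` inverts `1 / (2 - x)`.
      obtain ⟨u, hu, h3, h4⟩ := ihl (x := x / (1 - x))
        ⟨by positivity, by rw [div_le_one h2]; linarith⟩
      rw [le_div_iff₀ h2] at h3
      rw [div_le_iff₀ h2] at h4
      refine ⟨false :: u, by simp [BinTree.leaves, hu], ?_⟩
      rw [lo_cons_false, hi_cons_false, Set.mem_Icc, div_le_iff₀ (by linarith [(lo_mem_Icc u).1]),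
        le_div_iff₀ (by linarith [(hi_mem_Icc u).1])]
      exact ⟨by linarith, by linarith⟩
    · have h2 : 0 < x := by linarith
      obtain ⟨u, hu, h3, h4⟩ := ihr (x := (2 * x - 1) / x)
        ⟨div_nonneg (by linarith) h2.le, by rw [div_le_one h2]; linarith⟩
      rw [le_div_iff₀ h2] at h3
      rw [div_le_iff₀ h2] at h4
      refine ⟨true :: u, by simp [BinTree.leaves, hu], ?_⟩
      rw [lo_cons_true, hi_cons_true, Set.mem_Icc, div_le_iff₀ (by linarith [(lo_mem_Icc u).2]),
        le_div_iff₀ (by linarith [(hi_mem_Icc u).2])]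
      exact ⟨by linarith, by linarith⟩

theorem leaves_eq_replicate_false_cons (T : BinTree) :
    ∃ k l, T.leaves = List.replicate k false :: l := by
  induction T with
  | leaf => exact ⟨0, [], rfl⟩
  | node l r ihl _ =>
    obtain ⟨k, m, h⟩ := ihl
    exact ⟨k + 1, _, by rw [BinTree.leaves, h]; rfl⟩

theorem reverse_leaves_eq_replicate_true_cons (T : BinTree) :
    ∃ k l, T.leaves.reverse = List.replicate k true :: l := by
  induction T with
  | leaf => exact ⟨0, [], rfl⟩
  | node l r _ ihr =>
    obtain ⟨k, m, h⟩ := ihr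
    exact ⟨k + 1, _, by
      rw [BinTree.leaves, List.reverse_append, ← List.map_reverse, h]; rfl⟩

theorem prepend_replicate_const (k : ℕ) (b : Bool) :
    prepend (List.replicate k b) (fun _ => b) = fun _ => b := by
  induction k with
  | zero => rfl
  | succ k ih =>
    change cons b (prepend (List.replicate k b) fun _ => b) = _
    rw [ih, cons_const]

/-- The leftmost leaves of both trees consist of zeros only, and the rightmost of ones only;
reversing the lists puts the rightmost leaves in front. -/
theorem IsTreeDiagramMap.apply_const {f : Equiv.Perm Cantor} (hf : IsTreeDiagramMap f) (b : Bool) :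
    f (fun _ => b) = fun _ => b := by
  obtain ⟨L, R, h⟩ := hf
  have key (k m : ℕ) (h : ∀ ξ, f (prepend (List.replicate k b) ξ) =
      prepend (List.replicate m b) ξ) : f (fun _ => b) = fun _ => b := by
    have := h fun _ => b
    rwa [prepend_replicate_const, prepend_replicate_const] at this
  cases b
  · obtain ⟨k, l, hL⟩ := leaves_eq_replicate_false_cons L
    obtain ⟨m, r, hR⟩ := leaves_eq_replicate_false_cons R
    rw [hL, hR, List.forall₂_cons] at h
    exact key k m h.1
  · obtain ⟨k, l, hL⟩ := reverse_leaves_eq_replicate_true_cons L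
    obtain ⟨m, r, hR⟩ := reverse_leaves_eq_replicate_true_cons R
    rw [← List.forall₂_reverse_iff, hL, hR, List.forall₂_cons] at h
    exact key k m h.1

theorem exists_mobRel_symm (A : Matrix.SpecialLinearGroup (Fin 2) ℤ) :
    ∃ A' : Matrix.SpecialLinearGroup (Fin 2) ℤ, ∀ x y, MobRel A x y → MobRel A' y x := by
  refine ⟨slMk (A 1 1) (-A 0 1) (-A 1 0) (A 0 0) (by linarith [det_eq_one A]), fun x y h => ?_⟩
  rw [mobRel_slMk]
  unfold MobRel at h
  push_cast
  linear_combination -h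

theorem exists_mobRel_of_mem_Ioo {s : List Bool} {z : ℝ} (hz : z ∈ Set.Ioo (lo s) (hi s)) :
    ∃ x ∈ Set.Ioo (0 : ℝ) 1, MobRel (wordMat s) x z := by
  have hd := det_eq_one_real (wordMat s)
  have h0 := wordMat_denom_pos s (x := 0) (by simp)
  have h1 := wordMat_denom_pos s (x := 1) (by simp)
  rw [mul_zero, zero_add] at h0
  rw [mul_one] at h1
  obtain ⟨hl, hh⟩ := hz
  rw [lo, div_lt_iff₀ h0] at hl
  rw [hi, lt_div_iff₀ h1] at hh
  unfold MobRel
  generalize ((wordMat s 0 0 : ℤ) : ℝ) = a at *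
  generalize ((wordMat s 0 1 : ℤ) : ℝ) = b at *
  generalize ((wordMat s 1 0 : ℤ) : ℝ) = c at *
  generalize ((wordMat s 1 1 : ℤ) : ℝ) = d at *
  have hp : 0 < a - c * z := by linarith
  refine ⟨(d * z - b) / (a - c * z), ⟨div_pos (by linarith) hp, ?_⟩, ?_⟩
  · rw [div_lt_one hp]; linarith
  · have h := div_mul_cancel₀ (d * z - b) hp.ne'
    linear_combination -h

/-- A map that agrees with a tree diagram map in the unit interval model is piecewise
`PSL₂(ℤ)`. -/
theorem isPW_of_repPsi {f : Equiv.Perm Cantor} (hf : IsTreeDiagramMap f) {g : ℝ ≃o ℝ}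
    (hg : RepPsi f g) (hout : ∀ x, ¬ (0 < x ∧ x < 1) → g x = x) : IsPW g := by
  obtain ⟨L, R, hLR⟩ := hf
  refine ⟨{0, 1} ∪ (lo '' {u | u ∈ L.leaves} ∪ hi '' {u | u ∈ L.leaves}), ?_, ?_, ?_⟩
  · exact (Set.toFinite _).union (((List.finite_toSet _).image _).union
      ((List.finite_toSet _).image _))
  · rintro x ((rfl | rfl) | (⟨u, -, rfl⟩ | ⟨u, -, rfl⟩))
    · exact ⟨0, by simp⟩
    · exact ⟨1, by simp⟩
    · exact ⟨(wordMat u 0 1 : ℤ) / (wordMat u 1 1 : ℤ), by rw [lo]; push_cast; rfl⟩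
    · exact ⟨((wordMat u 0 0 : ℤ) + (wordMat u 0 1 : ℤ)) /
        ((wordMat u 1 0 : ℤ) + (wordMat u 1 1 : ℤ)), by rw [hi]; push_cast; rfl⟩
  intro x hx
  simp only [Set.mem_union, Set.mem_insert_iff, Set.mem_singleton_iff, not_or] at hx
  obtain ⟨⟨h0, h1⟩, hl, hh⟩ := hx
  have ident : ∀ s ∈ 𝓝 x, (∀ y ∈ s, ¬ (0 < y ∧ y < 1)) → LocMob g x := by
    intro s hs h
    refine ⟨1, ?_⟩
    filter_upwards [hs] with y hy
    rw [hout y (h y hy)]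
    exact MobRel.one y
  rcases lt_or_gt_of_ne h0 with h0 | h0
  · exact ident _ (Iio_mem_nhds h0) fun y hy h => lt_asymm h.1 hy
  rcases lt_or_gt_of_ne h1 with h1 | h1
  swap
  · exact ident _ (Ioi_mem_nhds h1) fun y hy h => lt_asymm h.2 hy
  obtain ⟨u, hu, hul, huh⟩ := exists_leaf_mem L ⟨h0.le, h1.le⟩
  have hul' : lo u < x := lt_of_le_of_ne hul fun h => hl ⟨u, hu, h⟩
  have huh' : x < hi u := lt_of_le_of_ne huh fun h => hh ⟨u, hu, h.symm⟩
  obtain ⟨v, hv⟩ : ∃ v, ∀ ξ, f (prepend u ξ) = prepend v ξ := by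
    obtain ⟨i, hi, rfl⟩ := List.mem_iff_getElem.1 hu
    exact ⟨_, hLR.get hi (hLR.length_eq ▸ hi)⟩
  obtain ⟨A', hA'⟩ := exists_mobRel_symm (wordMat u)
  refine ⟨wordMat v * A', ?_⟩
  filter_upwards [Ioo_mem_nhds hul' huh'] with y hy
  obtain ⟨z, hz, hzy⟩ := exists_mobRel_of_mem_Ioo hy
  refine MobRel.mul ?_ (hA' z y hzy)
  have cont (s : List Bool) : ContinuousAt (fun t : ℝ => (((wordMat s 0 0 : ℤ) : ℝ) * t +
      (wordMat s 0 1 : ℤ)) / ((wordMat s 1 0 : ℤ) * t + (wordMat s 1 1 : ℤ))) z :=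
    (hasDerivAt_projective (wordMat_denom_pos s ⟨hz.1.le, hz.2.le⟩).ne').continuousAt
  -- The semiconjugacy controls `g` only at values of `psi`. These include all rationals of `(0,
  -- 1)`, so the formula holds frequently near `z` and extends to `z` by continuity.
  have freq : ∃ᶠ t in 𝓝 z, g ((((wordMat u 0 0 : ℤ) : ℝ) * t + (wordMat u 0 1 : ℤ)) /
      ((wordMat u 1 0 : ℤ) * t + (wordMat u 1 1 : ℤ))) = (((wordMat v 0 0 : ℤ) : ℝ) * t +
      (wordMat v 0 1 : ℤ)) / ((wordMat v 1 0 : ℤ) * t + (wordMat v 1 1 : ℤ)) := by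
    have h : ∃ᶠ t in 𝓝 z, t ∈ Set.range ((↑) : ℚ → ℝ) :=
      mem_closure_iff_frequently.1 (Rat.denseRange_cast z)
    refine (h.and_eventually (Ioo_mem_nhds hz.1 hz.2)).mono ?_
    rintro _ ⟨⟨q, rfl⟩, hq⟩
    obtain ⟨ξ, hξ⟩ := exists_psi_eq_ratCast hq
    rw [← hξ, ← (isCoord_psi.mobRel u ξ).eq_div, ← (isCoord_psi.mobRel v ξ).eq_div, ← hg, hv]
  have e := tendsto_nhds_unique_of_frequently_eq
    ((g.continuous.continuousAt.comp (cont u)).tendsto) (cont v).tendsto freq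
  rw [Function.comp_apply, ← hzy.eq_div] at e
  rw [e, MobRel, div_mul_cancel₀]
  exact (wordMat_denom_pos v ⟨hz.1.le, hz.2.le⟩).ne'

/-! ### Words representing elements of `G₀` -/

theorem evalWord_cons (f : Equiv.Perm Cantor) (p : List Bool × ℤ) (L : List (List Bool × ℤ)) :
    evalWord f (p :: L) = evalWord (yAt p.1 ^ p.2 * f) L := rfl

/-- The map `q` is the product of the doubling powers; it does not depend on the initial map `f`,
and its total jump counts the exponents. -/
theorem exists_evalWord_eq (L : List (List Bool × ℤ)) : ∃ q : ℝ ≃o ℝ,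
    HasTotalJump q ((L.map Prod.snd).sum * (2 * Real.log 2)) ∧
      (∀ x, ¬ (0 < x ∧ x < 1) → q x = x) ∧
      ∀ (f : Equiv.Perm Cantor) (ξ : Cantor), psi (evalWord f L ξ) = q (psi (f ξ)) := by
  induction L with
  | nil => exact ⟨1, by simpa using HasTotalJump.one, fun _ _ => rfl, fun _ _ => rfl⟩
  | cons p L ih =>
    obtain ⟨q, hq, hq', hq''⟩ := ih
    refine ⟨q * double (lo p.1) (hi p.1) ^ p.2, ?_, fun x hx => ?_, fun f ξ => ?_⟩
    · rw [List.map_cons, List.sum_cons, Int.cast_add, add_mul, add_comm]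
      exact hq.mul ((hasTotalJump_double (lo_lt_hi p.1)).zpow p.2)
    · rw [RelIso.mul_apply, double_zpow_of_notMem, hq' x hx]
      exact fun h => hx ⟨(lo_mem_Icc _).1.trans_lt h.1, h.2.trans_le (hi_mem_Icc _).2⟩
    · rw [evalWord_cons, hq'', Equiv.Perm.mul_apply, ((repPsi_yAt p.1).zpow p.2)]
      rfl

/-- Over finite points this is `psi_eq_shrink`. Over `∞` the hypothesis cannot tell `000…` from
`111…`, which `psi` separates; there the word is computed directly, since `f` fixes both sequences
and the doublings fix `0` and `1`. -/
theorem repPsi_squeeze {f : Equiv.Perm Cantor} (hf : IsTreeDiagramMap f)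
    {L : List (List Bool × ℤ)} {g : ℝ ≃o ℝ} (h : Represents (evalWord f L) (toCirc g)) :
    RepPsi (evalWord f L) (squeeze g) := by
  intro ξ
  rcases hΦ : Phi ξ with _ | t
  · obtain ⟨b, rfl⟩ := eq_const_of_Phi_eq_infty hΦ
    obtain ⟨q, -, hq, hq'⟩ := exists_evalWord_eq L
    have hb : ¬ (0 < psi (fun _ => b) ∧ psi (fun _ => b) < 1) := by
      rw [psi_const]; cases b <;> simp
    rw [hq', hf.apply_const, hq _ hb, squeeze_of_notMem g hb]
  · have h1 := h ξ
    rw [hΦ] at h1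
    rw [psi_eq_shrink hΦ, squeeze_shrink]
    exact psi_eq_shrink h1

/-- Removing the doublings from `squeeze h` leaves a map represented by `f`. It is piecewise
`PSL₂(ℤ)`, so it has zero total jump, and the jump of `squeeze h` is that of the doublings. -/
theorem exponent_eq_sum {f : Equiv.Perm Cantor} (hf : IsTreeDiagramMap f)
    {L : List (List Bool × ℤ)} {h : G0} (hr : RepPsi (evalWord f L) (squeeze (lineMap h))) :
    exponent h = (L.map Prod.snd).sum := by
  obtain ⟨q, hq, hq', hq''⟩ := exists_evalWord_eq L
  have hk : IsPW (q⁻¹ * squeeze (lineMap h)) := by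
    refine isPW_of_repPsi hf (fun ξ => ?_) fun x hx => ?_
    · rw [RelIso.mul_apply, ← hr, hq'']
      exact (q.symm_apply_apply _).symm
    · rw [RelIso.mul_apply, squeeze_of_notMem _ hx]
      conv_lhs => rw [← hq' x hx]
      exact q.symm_apply_apply x
  have h1 := hq.mul hk.hasTotalJump
  rw [mul_inv_cancel_left, add_zero] at h1
  exact exponent_unique (hasTotalJump_lineMap h) h1

/-! ### Localized words -/

theorem locDigit_mul (b : Bool) (g h : Equiv.Perm Cantor) :
    locDigit b (g * h) = locDigit b g * locDigit b h := by
  ext1 ξ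
  change locFun b (g * h : Equiv.Perm Cantor) ξ = locFun b g (locFun b h ξ)
  by_cases h0 : ξ 0 = b <;> simp [locFun, h0]

theorem loc_mul (s : List Bool) (g h : Equiv.Perm Cantor) :
    loc s (g * h) = loc s g * loc s h := by
  induction s with
  | nil => rfl
  | cons b s ih => rw [loc, ih, locDigit_mul]; rfl

/-- Localization at a finite sequence, as a homomorphism. -/
def locHom (s : List Bool) : Equiv.Perm Cantor →* Equiv.Perm Cantor :=
  MonoidHom.mk' (loc s) (loc_mul s)

theorem evalWord_mul (f g : Equiv.Perm Cantor) (L : List (List Bool × ℤ)) :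
    evalWord (f * g) L = evalWord f L * g := by
  induction L generalizing f with
  | nil => rfl
  | cons p L ih => rw [evalWord_cons, evalWord_cons, ← ih, mul_assoc]

theorem evalWord_loc (f : Equiv.Perm Cantor) (L : List (List Bool × ℤ)) :
    evalWord (loc [true, false] f) (L.map fun p => (true :: false :: p.1, p.2)) =
      loc [true, false] (evalWord f L) := by
  induction L generalizing f with
  | nil => rfl
  | cons p L ih =>
    have e : yAt (true :: false :: p.1) ^ p.2 = loc [true, false] (yAt p.1 ^ p.2) :=
      (map_zpow (locHom [true, false]) (yAt p.1) p.2).symm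
    rw [List.map_cons, evalWord_cons, evalWord_cons, e, ← loc_mul, ih]

theorem Represents.mul {w v : Equiv.Perm Cantor} {g k : Circ ≃ₜ Circ} (hw : Represents w g)
    (hv : Represents v k) : Represents (w * v) (g * k) := fun ξ => by
  rw [Equiv.Perm.mul_apply, hw, hv]; rfl

theorem Represents.inv {w : Equiv.Perm Cantor} {g : Circ ≃ₜ Circ} (hw : Represents w g) :
    Represents w⁻¹ g⁻¹ := fun ξ => by
  have h : Phi ξ = g (Phi (w⁻¹ ξ)) := by
    rw [← hw]; exact congrArg _ (w.apply_symm_apply ξ).symm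
  rw [h]
  exact (g.symm_apply_apply _).symm

theorem represents_loc (s : List Bool) {w : Equiv.Perm Cantor} {g : Circ ≃ₜ Circ}
    (h1 : ∀ η, Phi (prepend s (w η)) = g (Phi (prepend s η)))
    (h2 : ∀ ξ, (∀ η, ξ ≠ prepend s η) → g (Phi ξ) = Phi ξ) : Represents (loc s w) g := by
  intro ξ
  by_cases h : ∃ η, ξ = prepend s η
  · obtain ⟨η, rfl⟩ := h
    rw [loc_prepend, h1]
  · rw [loc_of_not_extends s w ξ fun η hη => h ⟨η, hη⟩, h2 ξ fun η hη => h ⟨η, hη⟩]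

theorem Phi_zero_cons (ξ : Cantor) :
    Phi (cons false ξ) = OnePoint.infty ∨ ∃ t : ℝ, t ≤ 0 ∧ Phi (cons false ξ) = t := by
  rw [Phi, cons_zero, if_neg (by simp)]
  split_ifs
  · exact Or.inl rfl
  · exact Or.inr ⟨_, by simp, rfl⟩

theorem Phi_one_one (ξ : Cantor) : (phi ξ = ∞ ∧ Phi (cons true (cons true ξ)) = OnePoint.infty) ∨
    (phi ξ ≠ ∞ ∧ Phi (cons true (cons true ξ)) = ((1 + (phi ξ).toReal : ℝ) : Circ)) := by
  rw [Phi, cons_zero, if_pos rfl, tail_cons, phi_one]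
  by_cases h : phi ξ = ∞
  · exact Or.inl ⟨h, by simp [h]⟩
  · refine Or.inr ⟨h, ?_⟩
    rw [if_neg (ENNReal.add_ne_top.2 ⟨ENNReal.one_ne_top, h⟩),
      ENNReal.toReal_add ENNReal.one_ne_top h]
    rfl

theorem Phi_one_one_zero (ξ : Cantor) :
    Phi (cons true (cons true (cons false ξ))) = ((1 + psi ξ : ℝ) : Circ) := by
  rcases Phi_one_one (cons false ξ) with h | h
  · rw [phi_zero] at h
    exact absurd h.1 (ne_top_of_le_ne_top ENNReal.one_ne_top (half_le_one _))
  · exact h.2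

/-- The prefix `110` codes `[1, 2]` by `1 + psi`, so the doubling of `[0, 1]` is transported by the
unit translation. -/
theorem represents_yAt_one_one_zero :
    Represents (yAt [true, true, false]) (toCirc (double 1 2)) := by
  apply represents_loc
  · intro η
    change Phi (cons true (cons true (cons false (y η)))) =
      toCirc _ (Phi (cons true (cons true (cons false η))))
    rw [Phi_one_one_zero, Phi_one_one_zero, toCirc_coe, psi_y]
    congr 1
    have := double_projective (p := 0) (q := 1) (a := 1) (b := 1) (c := 0) (d := 1) one_pos
      (by norm_num) (by norm_num) (by norm_num) (psi_mem_Icc η)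
    norm_num at this
    rw [add_comm, ← this, add_comm 1]
  · intro ξ hξ
    have fix (t : ℝ) (h : t ≤ 1 ∨ 2 ≤ t) : toCirc (double 1 2) (t : Circ) = t := by
      rw [toCirc_coe, double_of_notMem]
      rintro ⟨h1, h2⟩
      rcases h with h | h <;> linarith
    obtain ⟨b, ξ, rfl⟩ := exists_eq_cons ξ
    obtain ⟨b', ξ, rfl⟩ := exists_eq_cons ξ
    obtain ⟨b'', ξ, rfl⟩ := exists_eq_cons ξ
    cases b
    · rcases Phi_zero_cons (cons b' (cons b'' ξ)) with h | ⟨t, ht, h⟩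
      · rw [h, toCirc_infty]
      · rw [h, fix t (Or.inl (by linarith))]
    cases b'
    · rw [Phi_one_zero]
      exact fix _ (Or.inl (psi_mem_Icc _).2)
    cases b''
    · exact absurd rfl (hξ ξ)
    · rcases Phi_one_one (cons true ξ) with ⟨-, h⟩ | ⟨h', h⟩
      · rw [h, toCirc_infty]
      · rw [h]
        refine fix _ (Or.inr ?_)
        rw [phi_one] at h' ⊢
        rw [ENNReal.toReal_add ENNReal.one_ne_top (ENNReal.add_ne_top.1 h').2, ENNReal.toReal_one]
        linarith [ENNReal.toReal_nonneg (a := phi ξ)]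

theorem represents_loc_one_zero {w : Equiv.Perm Cantor} {g : ℝ ≃o ℝ}
    (hw : RepPsi w (squeeze g)) :
    Represents (loc [true, false] w) (toCirc (squeeze g)) := by
  apply represents_loc
  · intro η
    change Phi (cons true (cons false (w η))) = toCirc _ (Phi (cons true (cons false η)))
    rw [Phi_one_zero, Phi_one_zero, toCirc_coe, hw]
  · intro ξ hξ
    have fix (t : ℝ) (h : t ≤ 0 ∨ 1 ≤ t) : toCirc (squeeze g) (t : Circ) = t := by
      rw [toCirc_coe, squeeze_of_notMem]
      rintro ⟨h1, h2⟩
      rcases h with h | h <;> linarith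
    obtain ⟨b, ξ, rfl⟩ := exists_eq_cons ξ
    obtain ⟨b', ξ, rfl⟩ := exists_eq_cons ξ
    cases b
    · rcases Phi_zero_cons (cons b' ξ) with h | ⟨t, ht, h⟩
      · rw [h, toCirc_infty]
      · rw [h, fix t (Or.inl ht)]
    cases b'
    · exact absurd rfl (hξ ξ)
    · rcases Phi_one_one ξ with ⟨-, h⟩ | ⟨-, h⟩
      · rw [h, toCirc_infty]
      · rw [h]
        exact fix _ (Or.inr (by linarith [ENNReal.toReal_nonneg (a := phi ξ)]))

/-- The leftmost letter acts first, so `y_{110}^{-t}` becomes the rightmost factor of the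
composition, as in the formula for the embedding. -/
theorem represents_embedding {f : Equiv.Perm Cantor} {L : List (List Bool × ℤ)}
    (hf : IsTreeDiagramMap f) {h : G0} (hr : Represents (evalWord f L) h) :
    Represents (evalImageWord f L) (embedding h) := by
  rw [← toCirc_lineMap] at hr
  have h1 := repPsi_squeeze hf hr
  have e : evalImageWord f L =
      loc [true, false] (evalWord f L) * yAt [true, true, false] ^ (-(L.map Prod.snd).sum) := by
    rw [← evalWord_loc, ← evalWord_mul]
    rfl
  rw [e, coe_embedding, exponent_eq_sum hf h1, map_mul, map_zpow]
  exact (represents_loc_one_zero h1).mul (zpow_pair (R := Represents) (fun _ => rfl)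
    Represents.mul Represents.inv represents_yAt_one_one_zero _)

end

end LodhaMoore

theorem mainTheorem4 :
    (∃ φ : LodhaMoore.G0 →* LodhaMoore.S, Function.Injective φ ∧
      ∀ (f : Equiv.Perm LodhaMoore.Cantor) (L : List (List Bool × ℤ)),
        LodhaMoore.IsStandardForm f L →
        ∀ h : LodhaMoore.G0,
          LodhaMoore.Represents (LodhaMoore.evalWord f L) h →
          LodhaMoore.Represents (LodhaMoore.evalImageWord f L) (φ h)) ∧
    ∃ ψ : LodhaMoore.BB12 →* LodhaMoore.S, Function.Injective ψ := by
  refine ⟨⟨LodhaMoore.embedding, LodhaMoore.embedding_injective,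
    fun f L hL h hr => LodhaMoore.represents_embedding hL.1 hr⟩, ?_⟩
  obtain ⟨j, hj⟩ := LodhaMoore.exists_injective_BB12_G0
  exact ⟨LodhaMoore.embedding.comp j, LodhaMoore.embedding_injective.comp hj⟩
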